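/- Let $d\ge 1$, let $\Omega\subseteq\mathbb R^d$ be a non-empty open set, and let $V\in C^1(\overline\Omega;\mathbb C)$ and $A\in C^2(\overline\Omega;\mathbb R^d)$ (for an open set $\Omega$, $f\in C^n(\overline\Omega)$ means that $f$ is $C^n$ in $\Omega$ and all its derivatives of order $\le n$ extend continuously to $\overline\Omega$). Write $V=V_1+iV_2$ with $V_1,V_2$ real, $B_{jk}=\partial_jA_k-\partial_kA_j$, $|B|=\big(\sum_{j,k}B_{jk}^2\big)^{1/2}$, $$m=\sqrt{1+|B|^2+|V|^2},\qquad \Phi=\frac{V_2}{m},\qquad \Psi=\frac{B}{m},\qquad |\nabla\Psi|^2=\sum_{j,k}|\nabla\Psi_{jk}|^2 .$$ Assume that there are constants $\gamma_1>0$ and $\gamma_2\in\mathbb R$ such that, everywhere in $\Omega$, $$\frac{V_2^2+\frac1{12d}|B|^2}{m}+V_1-9\big(|\nabla\Phi|^2+|\nabla\Psi|^2\big)\ \ge\ \gamma_1|V|-\gamma_2 .$$ Let $H^1_A(\Omega)=\{u\in L^2(\Omega):(-i\nabla+A)u\in L^2(\Omega)\}$ (in the sense of distributions), with norm $\big(\|u\|^2+\|(-i\nabla+A)u\|^2\big)^{1/2}$,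 let $H^1_{A,0}(\Omega)$ be the closure of $C_0^\infty(\Omega)$ in $H^1_A(\Omega)$, and let $$\mathscr V=\{u\in H^1_{A,0}(\Omega):|V|^{1/2}u\in L^2(\Omega)\},\qquad Q(u,v)=\langle(-i\nabla+A)u,(-i\nabla+A)v\rangle+\int_\Omega V u\bar v\,dx\quad(u,v\in\mathscr V),$$ where $\langle\cdot,\cdot\rangle$ is the $L^2$ inner product, linear in its first argument. Let $\mathscr L$ be the operator in $L^2(\Omega)$ with domain $$\mathsf{Dom}(\mathscr L)=\{u\in\mathscr V: v\mapsto Q(u,v)\ \text{is continuous on}\ \mathscr V\ \text{for the norm of}\ L^2(\Omega)\}$$ defined by $Q(u,v)=\langle\mathscr Lu,v\rangle$ for all $u\in\mathsf{Dom}(\mathscr L)$ and $v\in\mathscr V$. Then: (i) $\mathsf{Dom}(\mathscr L)$ is dense in $L^2(\Omega)$; (ii) $\mathscr L$ is closed; (iii) the resolvent set of $\mathscr L$, that is, the set of all $z\in\mathbb C$ such that $\mathscr L-z:\mathsf{Dom}(\mathscr L)\to L^2(\Omega)$ is bijective, is not empty. -/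

import Mathlib

open MeasureTheory
open scoped ContDiff ComplexConjugate

noncomputable section

namespace Electromagnetic

/-- The Euclidean space `ℝ^d`. -/
abbrev Space (d : ℕ) : Type := EuclideanSpace ℝ (Fin d)

/-- `f ∈ C^n(closure Ω)`: `f` is of class `C^n` in the open set `Ω`, and all its derivatives of
order at most `n` extend continuously from `Ω` to `closure Ω`. -/
def ContDiffUpToBoundary {d : ℕ} {F : Type*} [NormedAddCommGroup F] [NormedSpace ℝ F]
    (n : ℕ) (f : Space d → F) (Ω : Set (Space d)) : Prop :=
  ContDiffOn ℝ n f Ω ∧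
    ∀ k : ℕ, k ≤ n → ∃ g : Space d → (Space d [×k]→L[ℝ] F),
      ContinuousOn g (closure Ω) ∧ ∀ x ∈ Ω, g x = iteratedFDeriv ℝ k f x

/-- The data: a non-empty open set `Ω ⊆ ℝ^d`, a scalar potential `V ∈ C¹(closure Ω; ℂ)` and a
vector potential `A ∈ C²(closure Ω; ℝ^d)`. Only the values of `V` and `A` in `Ω` matter. -/
structure Potentials (d : ℕ) where
  Ω : Set (Space d)
  isOpen : IsOpen Ω
  nonempty : Ω.Nonempty
  V : Space d → ℂ
  A : Space d → Space d
  V_reg : ContDiffUpToBoundary 1 V Ω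
  A_reg : ContDiffUpToBoundary 2 A Ω

variable {d : ℕ}

/-- The `j`-th standard basis vector. -/
def basisVec (j : Fin d) : Space d := EuclideanSpace.single j 1

namespace Potentials

/-! ### The magnetic matrix, the weights and the condition on the potentials -/

/-- `B_{jk} = ∂_j A_k - ∂_k A_j`. -/
def B (S : Potentials d) (j k : Fin d) (x : Space d) : ℝ :=
  (fderiv ℝ S.A x (basisVec j)) k - (fderiv ℝ S.A x (basisVec k)) j

/-- `|B(x)|`, the Frobenius norm of the magnetic matrix. -/
def normB (S : Potentials d) (x : Space d) : ℝ :=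
  Real.sqrt (∑ j, ∑ k, S.B j k x ^ 2)

/-- `m = √(1 + |B|² + |V|²)`. -/
def m (S : Potentials d) (x : Space d) : ℝ :=
  Real.sqrt (1 + S.normB x ^ 2 + ‖S.V x‖ ^ 2)

/-- `Φ = (Im V) / m`. -/
def Phi (S : Potentials d) (x : Space d) : ℝ := (S.V x).im / S.m x

/-- `Ψ = B / m`, componentwise. -/
def Psi (S : Potentials d) (j k : Fin d) (x : Space d) : ℝ := S.B j k x / S.m x

/-- The standing inequality on the potentials: for some `γ₁ > 0` and `γ₂ ∈ ℝ`, in all of `Ω`,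
`(V₂² + |B|²/(12d)) / m + V₁ - 9 (|∇Φ|² + |∇Ψ|²) ≥ γ₁ |V| - γ₂`. -/
def WeightedCondition (S : Potentials d) : Prop :=
  ∃ γ₁ γ₂ : ℝ, 0 < γ₁ ∧ ∀ x ∈ S.Ω,
    ((S.V x).im ^ 2 + 1 / (12 * (d : ℝ)) * S.normB x ^ 2) / S.m x + (S.V x).re
        - 9 * (‖gradient S.Phi x‖ ^ 2 + ∑ j, ∑ k, ‖gradient (S.Psi j k) x‖ ^ 2)
      ≥ γ₁ * ‖S.V x‖ - γ₂

/-! ### The magnetic Sobolev spaces -/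

/-- The Hilbert space `L²(Ω; ℂ)`. -/
abbrev H (S : Potentials d) : Type := Lp ℂ 2 (volume.restrict S.Ω)

/-- The Hilbert space `L²(Ω; ℂ)^d ≅ L²(Ω; ℂ^d)`. -/
abbrev HVec (S : Potentials d) : Type := PiLp 2 (fun _ : Fin d => S.H)

/-- `φ ∈ C_0^∞(Ω)`. -/
structure IsTestFunction (S : Potentials d) (φ : Space d → ℂ) : Prop where
  smooth : ContDiff ℝ ∞ φ
  compact : HasCompactSupport φ
  subset : tsupport φ ⊆ S.Ω

/-- `w = (-i∇ + A) u` in the sense of distributions in `Ω`: for all `φ ∈ C_0^∞(Ω)` and all `j`,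
`∫ w_j φ = ∫ u (i ∂_j φ + A_j φ)`. -/
def IsMagneticGradient (S : Potentials d) (u : S.H) (w : S.HVec) : Prop :=
  ∀ φ : Space d → ℂ, S.IsTestFunction φ → ∀ j : Fin d,
    ∫ x in S.Ω, w j x * φ x
      = ∫ x in S.Ω, u x * (Complex.I * fderiv ℝ φ x (basisVec j) + (S.A x j : ℂ) * φ x)

namespace IsTestFunction

variable {S : Potentials d} {φ ψ : Space d → ℂ}

theorem continuous (h : S.IsTestFunction φ) : Continuous φ := h.smooth.continuous

theorem memLp (h : S.IsTestFunction φ) : MemLp φ 2 (volume.restrict S.Ω) :=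
  (h.continuous.memLp_of_hasCompactSupport h.compact).restrict _

theorem zero : S.IsTestFunction (0 : Space d → ℂ) :=
  ⟨contDiff_const, HasCompactSupport.zero, by simp [tsupport]⟩

theorem add (h : S.IsTestFunction φ) (h' : S.IsTestFunction ψ) :
    S.IsTestFunction (φ + ψ) :=
  ⟨h.smooth.add h'.smooth, h.compact.add h'.compact,
    (tsupport_add φ ψ).trans (Set.union_subset h.subset h'.subset)⟩

theorem const_smul (c : ℂ) (h : S.IsTestFunction φ) : S.IsTestFunction (c • φ) :=
  ⟨contDiff_const.smul h.smooth, h.compact.mono (Function.support_const_smul_subset c φ),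
    (closure_mono (Function.support_const_smul_subset c φ)).trans h.subset⟩

theorem star_comp (h : S.IsTestFunction φ) : S.IsTestFunction (fun x => conj (φ x)) := by
  have hs : Function.support (fun x => (starRingEnd ℂ) (φ x)) = Function.support φ := by
    ext x; simp
  refine ⟨Complex.conjCLE.contDiff.comp h.smooth, ?_, ?_⟩
  · have := h.compact
    rwa [HasCompactSupport, tsupport, hs]
  · have := h.subset
    rwa [tsupport, hs]

/-- A function continuous in `Ω`, times a test function, is continuous on the whole space. -/
theorem continuous_mul {a : Space d → ℂ} (ha : ContinuousOn a S.Ω) (h : S.IsTestFunction φ) :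
    Continuous (fun x => a x * φ x) := by
  rw [continuous_iff_continuousAt]
  intro x
  by_cases hx : x ∈ tsupport φ
  · exact (ha.continuousAt (S.isOpen.mem_nhds (h.subset hx))).mul h.continuous.continuousAt
  · have h0 : (fun x => a x * φ x) =ᶠ[nhds x] fun _ => 0 := by
      filter_upwards [(isClosed_tsupport φ).isOpen_compl.mem_nhds hx] with y hy
      simp [image_eq_zero_of_notMem_tsupport hy]
    exact h0.continuousAt

theorem memLp_mul {a : Space d → ℂ} (ha : ContinuousOn a S.Ω) (h : S.IsTestFunction φ) :
    MemLp (fun x => a x * φ x) 2 (volume.restrict S.Ω) :=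
  ((h.continuous_mul ha).memLp_of_hasCompactSupport h.compact.mul_left).restrict _

theorem fderiv_continuous (h : S.IsTestFunction φ) (j : Fin d) :
    Continuous (fun x => fderiv ℝ φ x (basisVec j)) :=
  (h.smooth.continuous_fderiv (by simp)).clm_apply continuous_const

theorem fderiv_compact (h : S.IsTestFunction φ) (j : Fin d) :
    HasCompactSupport (fun x => fderiv ℝ φ x (basisVec j)) :=
  h.compact.fderiv_apply ℝ (basisVec j)

theorem memLp_fderiv (h : S.IsTestFunction φ) (j : Fin d) :
    MemLp (fun x => fderiv ℝ φ x (basisVec j)) 2 (volume.restrict S.Ω) :=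
  ((h.fderiv_continuous j).memLp_of_hasCompactSupport (h.fderiv_compact j)).restrict _

end IsTestFunction

variable (S : Potentials d)

theorem continuousOn_A (j : Fin d) : ContinuousOn (fun x => ((S.A x j : ℝ) : ℂ)) S.Ω :=
  Complex.continuous_ofReal.comp_continuousOn
    ((EuclideanSpace.proj (𝕜 := ℝ) j).continuous.comp_continuousOn S.A_reg.1.continuousOn)

theorem continuousOn_V : ContinuousOn S.V S.Ω := S.V_reg.1.continuousOn

theorem aestronglyMeasurable_V : AEStronglyMeasurable S.V (volume.restrict S.Ω) :=
  S.continuousOn_V.aestronglyMeasurable S.isOpen.measurableSet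

variable {S}

theorem memLp_formalAdjoint {φ : Space d → ℂ} (h : S.IsTestFunction φ) (j : Fin d) :
    MemLp (fun x => Complex.I * fderiv ℝ φ x (basisVec j) + (S.A x j : ℂ) * φ x) 2
      (volume.restrict S.Ω) :=
  ((h.memLp_fderiv j).const_mul Complex.I).add (h.memLp_mul (S.continuousOn_A j))

/-- An element of `L²(Ω)` that annihilates all test functions vanishes. -/
theorem eq_zero_of_forall_integral (u : S.H)
    (h : ∀ φ : Space d → ℂ, S.IsTestFunction φ → ∫ x in S.Ω, u x * φ x = 0) : u = 0 := by
  have hu : MemLp u 2 (volume.restrict S.Ω) := Lp.memLp u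
  have hloc : LocallyIntegrableOn u S.Ω volume := by
    rw [locallyIntegrableOn_iff S.isOpen.isLocallyClosed]
    intro k hk hkc
    have h2 : MemLp u 2 (volume.restrict k) := hu.mono_measure (Measure.restrict_mono hk le_rfl)
    have : IsFiniteMeasure (volume.restrict k : Measure (Space d)) :=
      ⟨by simpa using hkc.measure_lt_top⟩
    exact h2.integrable (by norm_num)
  have hz := S.isOpen.ae_eq_zero_of_integral_contDiff_smul_eq_zero (μ := volume) hloc (by
    intro g hg hgc hgs
    have hsupp : Function.support (fun x => (g x : ℂ)) = Function.support g := by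
      ext x; simp
    have ht : S.IsTestFunction (fun x => (g x : ℂ)) := by
      refine ⟨Complex.ofRealCLM.contDiff.comp hg, ?_, ?_⟩
      · rwa [HasCompactSupport, tsupport, hsupp]
      · rwa [tsupport, hsupp]
    have h1 := h _ ht
    rw [← h1, ← setIntegral_eq_integral_of_forall_compl_eq_zero (s := S.Ω)]
    · refine integral_congr_ae (Filter.Eventually.of_forall fun x => ?_)
      simp [mul_comm]
    · intro x hx
      have : g x = 0 := image_eq_zero_of_notMem_tsupport fun h' => hx (hgs h')
      simp [this])
  rw [Lp.eq_zero_iff_ae_eq_zero]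
  filter_upwards [(ae_restrict_iff' S.isOpen.measurableSet).2 hz] with x hx
  simpa using hx

theorem integrable_mul_memLp (u : S.H) {f : Space d → ℂ}
    (hf : MemLp f 2 (volume.restrict S.Ω)) :
    Integrable (fun x => u x * f x) (volume.restrict S.Ω) :=
  (Lp.memLp u).integrable_mul hf

namespace IsMagneticGradient

variable {u u' : S.H} {w w' : S.HVec}

theorem zero : S.IsMagneticGradient 0 0 := by
  intro φ _ j
  have h0 : ((0 : S.H) : Space d → ℂ) =ᵐ[volume.restrict S.Ω] 0 := Lp.coeFn_zero _ _ _
  refine integral_congr_ae ?_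
  filter_upwards [h0] with x hx
  rw [PiLp.zero_apply, hx, Pi.zero_apply, zero_mul, zero_mul]

theorem add (h : S.IsMagneticGradient u w) (h' : S.IsMagneticGradient u' w') :
    S.IsMagneticGradient (u + u') (w + w') := by
  intro φ hφ j
  have e1 : ∫ x in S.Ω, (w + w') j x * φ x
      = ∫ x in S.Ω, (w j x * φ x + w' j x * φ x) := by
    refine integral_congr_ae ?_
    filter_upwards [Lp.coeFn_add (w j) (w' j)] with x hx
    rw [PiLp.add_apply, hx, Pi.add_apply, add_mul]
  have e2 : ∫ x in S.Ω, (u + u') x * (Complex.I * fderiv ℝ φ x (basisVec j) + (S.A x j : ℂ) * φ x)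
      = ∫ x in S.Ω, (u x * (Complex.I * fderiv ℝ φ x (basisVec j) + (S.A x j : ℂ) * φ x)
        + u' x * (Complex.I * fderiv ℝ φ x (basisVec j) + (S.A x j : ℂ) * φ x)) := by
    refine integral_congr_ae ?_
    filter_upwards [Lp.coeFn_add u u'] with x hx
    simp only [hx, Pi.add_apply, add_mul]
  rw [e1, e2, integral_add (integrable_mul_memLp _ hφ.memLp)
    (integrable_mul_memLp _ hφ.memLp),
    integral_add (integrable_mul_memLp _ (memLp_formalAdjoint hφ j))
    (integrable_mul_memLp _ (memLp_formalAdjoint hφ j)), h φ hφ j, h' φ hφ j]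

theorem smul (c : ℂ) (h : S.IsMagneticGradient u w) :
    S.IsMagneticGradient (c • u) (c • w) := by
  intro φ hφ j
  have e1 : ∫ x in S.Ω, (c • w) j x * φ x = ∫ x in S.Ω, c * (w j x * φ x) := by
    refine integral_congr_ae ?_
    filter_upwards [Lp.coeFn_smul c (w j)] with x hx
    simp [hx, mul_assoc]
  have e2 : ∫ x in S.Ω, (c • u) x * (Complex.I * fderiv ℝ φ x (basisVec j) + (S.A x j : ℂ) * φ x)
      = ∫ x in S.Ω, c * (u x *
        (Complex.I * fderiv ℝ φ x (basisVec j) + (S.A x j : ℂ) * φ x)) := by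
    refine integral_congr_ae ?_
    filter_upwards [Lp.coeFn_smul c u] with x hx
    simp only [hx, Pi.smul_apply, smul_eq_mul, mul_assoc]
  rw [e1, e2, integral_const_mul, integral_const_mul, h φ hφ j]

theorem unique (h : S.IsMagneticGradient u w) (h' : S.IsMagneticGradient u w') : w = w' := by
  ext1 j
  rw [← sub_eq_zero]
  refine eq_zero_of_forall_integral _ fun φ hφ => ?_
  have e1 : ∫ x in S.Ω, (w j - w' j : S.H) x * φ x
      = ∫ x in S.Ω, (w j x * φ x - w' j x * φ x) := by
    refine integral_congr_ae ?_
    filter_upwards [Lp.coeFn_sub (w j) (w' j)] with x hx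
    rw [hx, Pi.sub_apply, sub_mul]
  rw [e1, integral_sub (integrable_mul_memLp _ hφ.memLp)
    (integrable_mul_memLp _ hφ.memLp), h φ hφ j, h' φ hφ j, sub_self]

end IsMagneticGradient

variable (S)

/-- The magnetic Sobolev space `H¹_A(Ω) = {u ∈ L²(Ω) : (-i∇ + A) u ∈ L²(Ω)}`. -/
def H1A : Submodule ℂ S.H where
  carrier := {u | ∃ w : S.HVec, S.IsMagneticGradient u w}
  zero_mem' := ⟨0, .zero⟩
  add_mem' := fun ⟨w, hw⟩ ⟨w', hw'⟩ => ⟨w + w', hw.add hw'⟩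
  smul_mem' := fun c _ ⟨w, hw⟩ => ⟨c • w, hw.smul c⟩

/-- `u ↦ (-i∇ + A) u` as a linear map `H¹_A(Ω) → L²(Ω)^d`. -/
def magGrad : S.H1A →ₗ[ℂ] S.HVec where
  toFun u := u.2.choose
  map_add' u v := (u + v).2.choose_spec.unique (u.2.choose_spec.add v.2.choose_spec)
  map_smul' c u := (c • u).2.choose_spec.unique (u.2.choose_spec.smul c)

theorem isMagneticGradient_magGrad (u : S.H1A) : S.IsMagneticGradient u (S.magGrad u) :=
  u.2.choose_spec

/-- The embedding `u ↦ (u, (-i∇ + A) u)` of `H¹_A(Ω)` into `L²(Ω) × L²(Ω)^d`, which induces the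
norm of `H¹_A(Ω)`. -/
def h1Embedding : S.H1A →ₗ[ℂ] WithLp 2 (S.H × S.HVec) :=
  (WithLp.linearEquiv 2 ℂ (S.H × S.HVec)).symm.toLinearMap ∘ₗ
    (S.H1A.subtype.prod S.magGrad)

/-- The norm induced by `h1Embedding` is `√(‖u‖² + ‖(-i∇ + A) u‖²)`. -/
theorem norm_h1Embedding (u : S.H1A) :
    ‖S.h1Embedding u‖ = Real.sqrt (‖(u : S.H)‖ ^ 2 + ‖S.magGrad u‖ ^ 2) :=
  WithLp.prod_norm_eq_of_L2 _

/-- The space `C_0^∞(Ω)`, inside `H¹_A(Ω)`. -/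
def testSpace : Submodule ℂ S.H1A where
  carrier := {u | ∃ φ : Space d → ℂ, S.IsTestFunction φ ∧
    ((u : S.H) : Space d → ℂ) =ᵐ[volume.restrict S.Ω] φ}
  zero_mem' := ⟨0, .zero, Lp.coeFn_zero _ _ _⟩
  add_mem' := fun ⟨φ, hφ, h⟩ ⟨ψ, hψ, h'⟩ =>
    ⟨φ + ψ, hφ.add hψ, (Lp.coeFn_add _ _).trans (h.add h')⟩
  smul_mem' := fun c _ ⟨φ, hφ, h⟩ =>
    ⟨c • φ, hφ.const_smul c, (Lp.coeFn_smul _ _).trans (h.const_smul c)⟩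

/-- `H¹_{A,0}(Ω)`: the closure of `C_0^∞(Ω)` in `H¹_A(Ω)` for the norm of `H¹_A(Ω)`. -/
def H1A0 : Submodule ℂ S.H1A :=
  ((S.testSpace.map S.h1Embedding).topologicalClosure).comap S.h1Embedding

/-! ### The variational space, the form and the operator -/

/-- The variational space `𝒱 = {u ∈ H¹_{A,0}(Ω) : |V|^{1/2} u ∈ L²(Ω)}`, as a subspace of `L²(Ω)`.
-/
def variationalSpace : Submodule ℂ S.H where
  carrier := {u | u ∈ S.H1A0.map S.H1A.subtype ∧
    MemLp (fun x => ((Real.sqrt ‖S.V x‖ : ℝ) : ℂ) * u x) 2 (volume.restrict S.Ω)}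
  zero_mem' := by
    refine ⟨Submodule.zero_mem _, (memLp_congr_ae ?_).2 (MemLp.zero (ε := ℂ))⟩
    filter_upwards [Lp.coeFn_zero ℂ 2 (volume.restrict S.Ω)] with x hx
    rw [hx, Pi.zero_apply, mul_zero]
  add_mem' := by
    rintro u v ⟨hu, hu'⟩ ⟨hv, hv'⟩
    refine ⟨Submodule.add_mem _ hu hv, (memLp_congr_ae ?_).2 (hu'.add hv')⟩
    filter_upwards [Lp.coeFn_add u v] with x hx
    rw [hx, Pi.add_apply, mul_add, Pi.add_apply]
  smul_mem' := by
    rintro c u ⟨hu, hu'⟩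
    refine ⟨Submodule.smul_mem _ c hu, (memLp_congr_ae ?_).2 (hu'.const_mul c)⟩
    filter_upwards [Lp.coeFn_smul c u] with x hx
    simp [hx]
    ring

theorem variationalSpace_le : S.variationalSpace ≤ S.H1A := by
  rintro u ⟨⟨v, _, rfl⟩, _⟩
  exact v.2

/-- `u ↦ (-i∇ + A) u` on the variational space. -/
def magGradV : S.variationalSpace →ₗ[ℂ] S.HVec :=
  S.magGrad ∘ₗ Submodule.inclusion S.variationalSpace_le

/-- The form `Q(u, v) = ⟨(-i∇ + A) u, (-i∇ + A) v⟩ + ∫ V u v̄`. The inner product of the text is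
linear in its first argument, whereas Mathlib's `inner` is linear in the second one. -/
def Q (u v : S.variationalSpace) : ℂ :=
  inner ℂ (S.magGradV v) (S.magGradV u)
    + ∫ x in S.Ω, S.V x * (u : S.H) x * conj ((v : S.H) x)

theorem integrable_Q (u v : S.variationalSpace) :
    IntegrableOn (fun x => S.V x * (u : S.H) x * conj ((v : S.H) x)) S.Ω := by
  have h := u.2.2.norm.integrable_mul v.2.2.norm
  refine h.mono ((S.aestronglyMeasurable_V.mul (Lp.aestronglyMeasurable _)).mul
    (Complex.continuous_conj.comp_aestronglyMeasurable (Lp.aestronglyMeasurable _))) ?_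
  refine Filter.Eventually.of_forall fun x => le_of_eq ?_
  have hs := Real.mul_self_sqrt (norm_nonneg (S.V x))
  simp only [norm_mul, RCLike.norm_conj, Pi.mul_apply, Complex.norm_real, Real.norm_eq_abs,
    abs_norm, abs_of_nonneg (Real.sqrt_nonneg _)]
  linear_combination (-‖(u : S.H) x‖ * ‖(v : S.H) x‖) * hs

theorem Q_add_left (u u' v : S.variationalSpace) : S.Q (u + u') v = S.Q u v + S.Q u' v := by
  have e : ∫ x in S.Ω, S.V x * ((u + u' : S.variationalSpace) : S.H) x * conj ((v : S.H) x)
      = ∫ x in S.Ω, (S.V x * (u : S.H) x * conj ((v : S.H) x)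
        + S.V x * (u' : S.H) x * conj ((v : S.H) x)) := by
    refine integral_congr_ae ?_
    filter_upwards [Lp.coeFn_add (u : S.H) (u' : S.H)] with x hx
    simp only [Submodule.coe_add, hx, Pi.add_apply]
    ring
  rw [Q, e, integral_add (S.integrable_Q u v) (S.integrable_Q u' v), map_add, inner_add_right,
    Q, Q]
  ring

theorem Q_smul_left (c : ℂ) (u v : S.variationalSpace) : S.Q (c • u) v = c * S.Q u v := by
  have e : ∫ x in S.Ω, S.V x * ((c • u : S.variationalSpace) : S.H) x * conj ((v : S.H) x)
      = ∫ x in S.Ω, c * (S.V x * (u : S.H) x * conj ((v : S.H) x)) := by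
    refine integral_congr_ae ?_
    filter_upwards [Lp.coeFn_smul c (u : S.H)] with x hx
    simp only [Submodule.coe_smul, hx, Pi.smul_apply, smul_eq_mul]
    ring
  rw [Q, e, integral_const_mul, map_smul, inner_smul_right, Q]
  ring

theorem Q_add_right (u v v' : S.variationalSpace) : S.Q u (v + v') = S.Q u v + S.Q u v' := by
  have e : ∫ x in S.Ω, S.V x * (u : S.H) x * conj (((v + v' : S.variationalSpace) : S.H) x)
      = ∫ x in S.Ω, (S.V x * (u : S.H) x * conj ((v : S.H) x)
        + S.V x * (u : S.H) x * conj ((v' : S.H) x)) := by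
    refine integral_congr_ae ?_
    filter_upwards [Lp.coeFn_add (v : S.H) (v' : S.H)] with x hx
    simp only [Submodule.coe_add, hx, Pi.add_apply, map_add]
    ring
  rw [Q, e, integral_add (S.integrable_Q u v) (S.integrable_Q u v'), map_add, inner_add_left,
    Q, Q]
  ring

theorem Q_smul_right (c : ℂ) (u v : S.variationalSpace) :
    S.Q u (c • v) = conj c * S.Q u v := by
  have e : ∫ x in S.Ω, S.V x * (u : S.H) x * conj (((c • v : S.variationalSpace) : S.H) x)
      = ∫ x in S.Ω, conj c * (S.V x * (u : S.H) x * conj ((v : S.H) x)) := by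
    refine integral_congr_ae ?_
    filter_upwards [Lp.coeFn_smul c (v : S.H)] with x hx
    simp only [Submodule.coe_smul, hx, Pi.smul_apply, smul_eq_mul, map_mul]
    ring
  rw [Q, e, integral_const_mul, map_smul, inner_smul_left, Q]
  ring

/-- Test functions belong to `H¹_A(Ω)`. -/
theorem test_mem_H1A {φ : Space d → ℂ} (hφ : S.IsTestFunction φ) :
    hφ.memLp.toLp φ ∈ S.H1A := by
  have hm : ∀ j : Fin d, MemLp (fun x => -Complex.I * fderiv ℝ φ x (basisVec j)
      + (S.A x j : ℂ) * φ x) 2 (volume.restrict S.Ω) := fun j =>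
    ((hφ.memLp_fderiv j).const_mul (-Complex.I)).add (hφ.memLp_mul (S.continuousOn_A j))
  refine ⟨WithLp.toLp 2 fun j => (hm j).toLp _, fun ψ hψ j => ?_⟩
  have e1 : ∫ x in S.Ω, ((hm j).toLp _ : S.H) x * ψ x
      = ∫ x in S.Ω, ((-Complex.I) * (fderiv ℝ φ x (basisVec j) * ψ x)
        + (S.A x j : ℂ) * φ x * ψ x) := by
    refine integral_congr_ae ?_
    filter_upwards [(hm j).coeFn_toLp] with x hx
    rw [hx]
    ring
  have e2 : ∫ x in S.Ω, (hφ.memLp.toLp φ : S.H) x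
        * (Complex.I * fderiv ℝ ψ x (basisVec j) + (S.A x j : ℂ) * ψ x)
      = ∫ x in S.Ω, (Complex.I * (φ x * fderiv ℝ ψ x (basisVec j))
        + (S.A x j : ℂ) * φ x * ψ x) := by
    refine integral_congr_ae ?_
    filter_upwards [hφ.memLp.coeFn_toLp] with x hx
    rw [hx]
    ring
  have i1 : Integrable (fun x => fderiv ℝ φ x (basisVec j) * ψ x) :=
    ((hφ.fderiv_continuous j).mul hψ.continuous).integrable_of_hasCompactSupport
      hψ.compact.mul_left
  have i2 : Integrable (fun x => φ x * fderiv ℝ ψ x (basisVec j)) :=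
    (hφ.continuous.mul (hψ.fderiv_continuous j)).integrable_of_hasCompactSupport
      hφ.compact.mul_right
  have i3 : Integrable (fun x => φ x * ψ x) :=
    (hφ.continuous.mul hψ.continuous).integrable_of_hasCompactSupport hφ.compact.mul_right
  have i4 : IntegrableOn (fun x => (S.A x j : ℂ) * φ x * ψ x) S.Ω :=
    (hφ.memLp_mul (S.continuousOn_A j)).integrable_mul hψ.memLp
  have ibp := integral_mul_fderiv_eq_neg_fderiv_mul_of_integrable (μ := volume)
    (v := basisVec j) i1 i2 i3 (fun x _ => hφ.smooth.differentiable (by simp) x)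
    (fun x _ => hψ.smooth.differentiable (by simp) x)
  have r1 : ∫ x in S.Ω, fderiv ℝ φ x (basisVec j) * ψ x
      = ∫ x, fderiv ℝ φ x (basisVec j) * ψ x := by
    refine setIntegral_eq_integral_of_forall_compl_eq_zero fun x hx => ?_
    rw [image_eq_zero_of_notMem_tsupport fun h' => hx (hψ.subset h'), mul_zero]
  have r2 : ∫ x in S.Ω, φ x * fderiv ℝ ψ x (basisVec j)
      = ∫ x, φ x * fderiv ℝ ψ x (basisVec j) := by
    refine setIntegral_eq_integral_of_forall_compl_eq_zero fun x hx => ?_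
    rw [image_eq_zero_of_notMem_tsupport fun h' => hx (hφ.subset h'), zero_mul]
  have e3 := integral_add (μ := volume.restrict S.Ω)
    ((i1.integrableOn (s := S.Ω)).const_mul (-Complex.I)) i4
  have e4 := integral_add (μ := volume.restrict S.Ω)
    ((i2.integrableOn (s := S.Ω)).const_mul Complex.I) i4
  rw [e2]
  refine e1.trans (e3.trans (Eq.trans ?_ e4.symm))
  rw [integral_const_mul, integral_const_mul, r1, r2, ibp]
  ring

/-- Test functions belong to the variational space. -/
theorem test_mem_variationalSpace {φ : Space d → ℂ} (hφ : S.IsTestFunction φ) :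
    hφ.memLp.toLp φ ∈ S.variationalSpace := by
  refine ⟨⟨⟨_, S.test_mem_H1A hφ⟩, ?_, rfl⟩, ?_⟩
  · exact Submodule.le_topologicalClosure _
      (Submodule.mem_map_of_mem ⟨φ, hφ, hφ.memLp.coeFn_toLp⟩)
  · have hc : ContinuousOn (fun x => ((Real.sqrt ‖S.V x‖ : ℝ) : ℂ)) S.Ω :=
      (Complex.continuous_ofReal.comp Real.continuous_sqrt).comp_continuousOn
        S.continuousOn_V.norm
    refine (memLp_congr_ae ?_).2 (hφ.memLp_mul hc)
    filter_upwards [hφ.memLp.coeFn_toLp] with x hx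
    rw [hx]

/-- The variational space separates the points of `L²(Ω)`. -/
theorem eq_of_forall_inner {f g : S.H}
    (h : ∀ v : S.variationalSpace, inner ℂ (v : S.H) f = inner ℂ (v : S.H) g) : f = g := by
  rw [← sub_eq_zero]
  refine eq_zero_of_forall_integral _ fun φ hφ => ?_
  have h1 := h ⟨_, S.test_mem_variationalSpace hφ.star_comp⟩
  rw [← sub_eq_zero, ← inner_sub_right, L2.inner_def] at h1
  rw [← h1]
  refine integral_congr_ae ?_
  filter_upwards [hφ.star_comp.memLp.coeFn_toLp] with x hx
  simp [hx]

/-- The Riesz theorem: if `v ↦ Q(u, v)` is continuous on `𝒱` for the norm of `L²(Ω)`, then it is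
`v ↦ ⟨f, v⟩` for some `f ∈ L²(Ω)`. -/
theorem exists_riesz (u : S.variationalSpace) (hu : Continuous fun v => S.Q u v) :
    ∃ f : S.H, ∀ v : S.variationalSpace, S.Q u v = inner ℂ (v : S.H) f := by
  let l : S.variationalSpace →L[ℂ] ℂ :=
    { toFun := fun v => conj (S.Q u v)
      map_add' := fun v v' => by rw [S.Q_add_right, map_add]
      map_smul' := fun c v => by
        rw [S.Q_smul_right, map_mul, Complex.conj_conj, smul_eq_mul, RingHom.id_apply]
      cont := Complex.continuous_conj.comp hu }
  obtain ⟨g, hg, _⟩ := exists_extension_norm_eq S.variationalSpace l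
  refine ⟨(InnerProductSpace.toDual ℂ S.H).symm g, fun v => ?_⟩
  rw [← inner_conj_symm, InnerProductSpace.toDual_symm_apply, hg]
  exact (Complex.conj_conj _).symm

/-- `Dom(ℒ)`: the `u ∈ 𝒱` such that `v ↦ Q(u, v)` is continuous on `𝒱` for the norm of `L²(Ω)`
(`variationalSpace` carries the topology of `L²(Ω)`). -/
def operatorDomain : Submodule ℂ S.H where
  carrier := {u | ∃ hu : u ∈ S.variationalSpace, Continuous fun v => S.Q ⟨u, hu⟩ v}
  zero_mem' := by
    refine ⟨Submodule.zero_mem _, ?_⟩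
    have : (fun v => S.Q ⟨0, Submodule.zero_mem _⟩ v) = fun _ => 0 := by
      funext v
      have h := S.Q_smul_left 0 0 v
      rw [zero_smul, zero_mul] at h
      exact h
    rw [this]
    exact continuous_const
  add_mem' := by
    rintro u u' ⟨hu, hc⟩ ⟨hu', hc'⟩
    refine ⟨Submodule.add_mem _ hu hu', ?_⟩
    have : (fun v => S.Q ⟨u + u', Submodule.add_mem _ hu hu'⟩ v)
        = fun v => S.Q ⟨u, hu⟩ v + S.Q ⟨u', hu'⟩ v := by
      funext v
      exact S.Q_add_left ⟨u, hu⟩ ⟨u', hu'⟩ v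
    rw [this]
    exact hc.add hc'
  smul_mem' := by
    rintro c u ⟨hu, hc⟩
    refine ⟨Submodule.smul_mem _ c hu, ?_⟩
    have : (fun v => S.Q ⟨c • u, Submodule.smul_mem _ c hu⟩ v)
        = fun v => c * S.Q ⟨u, hu⟩ v := by
      funext v
      exact S.Q_smul_left c ⟨u, hu⟩ v
    rw [this]
    exact continuous_const.mul hc

theorem operatorDomain_le : S.operatorDomain ≤ S.variationalSpace := fun _ h => h.1

/-- The existence and (by `eq_of_forall_inner`) uniqueness of `ℒ u`. -/
theorem exists_operator (u : S.operatorDomain) :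
    ∃ f : S.H, ∀ v : S.variationalSpace,
      S.Q (Submodule.inclusion S.operatorDomain_le u) v = inner ℂ (v : S.H) f :=
  S.exists_riesz _ u.2.2

/-- The operator `ℒ` in `L²(Ω)` defined by `Q(u, v) = ⟨ℒ u, v⟩` for `u ∈ Dom(ℒ)`, `v ∈ 𝒱`. -/
def operator : S.H →ₗ.[ℂ] S.H where
  domain := S.operatorDomain
  toFun :=
    { toFun := fun u => (S.exists_operator u).choose
      map_add' := fun u u' => S.eq_of_forall_inner fun v => by
        rw [← (S.exists_operator (u + u')).choose_spec v, inner_add_right,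
          ← (S.exists_operator u).choose_spec v, ← (S.exists_operator u').choose_spec v,
          map_add, S.Q_add_left]
      map_smul' := fun c u => S.eq_of_forall_inner fun v => by
        rw [← (S.exists_operator (c • u)).choose_spec v, RingHom.id_apply, inner_smul_right,
          ← (S.exists_operator u).choose_spec v, map_smul, S.Q_smul_left] }

/-- The defining property of `ℒ`. -/
theorem Q_eq_inner_operator (u : S.operator.domain) (v : S.variationalSpace) :
    S.Q (Submodule.inclusion S.operatorDomain_le u) v = inner ℂ (v : S.H) (S.operator u) :=
  (S.exists_operator u).choose_spec v

end Potentials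

/-- The resolvent set of an operator `T` in a Hilbert space: the `z ∈ ℂ` such that `T - z` is
bijective from `Dom(T)` onto the space (for closed `T` the inverse is then bounded). -/
def resolventSet {X : Type*} [NormedAddCommGroup X] [InnerProductSpace ℂ X]
    (T : X →ₗ.[ℂ] X) : Set ℂ :=
  {z | Function.Bijective fun u : T.domain => T u - z • (u : X)}

end Electromagnetic

end

/-! The real part of `Q(u, u)` need not control anything, since `V₁` may be very negative. What
works is to pair `u` with `(1 + iΦ)u`. With `P = -i∇ + A`, the real part of the potential term
becomes `∫ (V₁ + ΦV₂)|u|²`, where `ΦV₂ = V₂²/m`. The kinetic term costs only a commutator with `Φ`: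
it is at least `¾‖Pu‖² - ∫ |∇Φ|²|u|²`.

The `|B|²` term of the hypothesis comes from the kinetic energy. Since `[P_j, P_k] = -iB_{jk}`,
pairing the commutator with `Ψ_{jk}u` and summing gives `∫ (|B|²/m)|u|² ≤ 3d‖Pu‖² + ∫ |∇Ψ|²|u|²`
(`integral_normB_le`). After division by `12d` this uses a quarter of `‖Pu‖²`. With the weight
condition, `Re (Q + c)(u, (1 + iΦ)u)` then dominates the squared variational norm for `c = |γ₂| + 1`
(`coercive_graphMap`).

For this to replace ordinary coercivity, multiplication by `1 + iΦ` must be bounded and invertible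
for the variational norm. The condition itself bounds `∫ |∇Φ|²|u|²` by that norm
(`integral_gradient_Phi_le`), and `|1 + iΦ| ≥ 1` makes the inverse a multiplier of the same kind. If
`M` is the multiplication and `𝒜` the bounded operator of the form `Q + c`, then `M*𝒜` is coercive,
hence bijective by Lax–Milgram. As `M*` is bijective, so is `𝒜` (`bijective_coerciveOp`).

This takes place in the closure of `C¹_0(Ω)` under `f ↦ (f, |V|^{1/2}f, Pf)`. The class `C¹` is used
because `Φ` and `Ψ` are only `C¹`, so `C_0^∞` is not stable under multiplication by them;
mollification shows that the closure is the same. The closure is identified with `𝒱` by cutting off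
at infinity, using that `V` is bounded on bounded parts of `Ω` (`graphV_mem_formSpace`,
`graphV_of_formSpace`). If `ι` embeds the completion into `L²(Ω)`, then `(ℒ + c)⁻¹ = ι𝒜⁻¹ι*`, and
the three assertions follow from this formula and the bijectivity of `𝒜`. -/

noncomputable section

namespace Electromagnetic
namespace Potentials

variable {d : ℕ}

/-! ### Regularity and boundedness of the weights -/

section ScalarRegularity

variable (S : Potentials d)

theorem contDiffOn_fderiv_A : ContDiffOn ℝ 1 (fderiv ℝ S.A) S.Ω :=
  S.A_reg.1.fderiv_of_isOpen S.isOpen (by norm_num)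

theorem contDiffOn_B (j k : Fin d) : ContDiffOn ℝ 1 (S.B j k) S.Ω := by
  have h (j k : Fin d) : ContDiffOn ℝ 1 (fun x => (fderiv ℝ S.A x (basisVec j)) k) S.Ω :=
    (EuclideanSpace.proj (𝕜 := ℝ) k).contDiff.comp_contDiffOn
      (S.contDiffOn_fderiv_A.clm_apply contDiffOn_const)
  exact (h j k).sub (h k j)

theorem normB_sq (x : Space d) : S.normB x ^ 2 = ∑ j, ∑ k, S.B j k x ^ 2 :=
  Real.sq_sqrt (Finset.sum_nonneg fun _ _ => Finset.sum_nonneg fun _ _ => sq_nonneg _)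

theorem m_pos (x : Space d) : 0 < S.m x := Real.sqrt_pos.2 (by positivity)

theorem norm_V_le_m (x : Space d) : ‖S.V x‖ ≤ S.m x :=
  Real.le_sqrt_of_sq_le (by nlinarith [sq_nonneg (S.normB x)])

theorem abs_B_le_m (j k : Fin d) (x : Space d) : |S.B j k x| ≤ S.m x := by
  refine Real.le_sqrt_of_sq_le ?_
  rw [sq_abs]
  have h1 : S.B j k x ^ 2 ≤ S.normB x ^ 2 := by
    rw [normB_sq]
    exact (Finset.single_le_sum (f := fun k => S.B j k x ^ 2) (fun _ _ => sq_nonneg _)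
      (Finset.mem_univ k)).trans (Finset.single_le_sum (f := fun j => ∑ k, S.B j k x ^ 2)
        (fun _ _ => Finset.sum_nonneg fun _ _ => sq_nonneg _) (Finset.mem_univ j))
  nlinarith [sq_nonneg ‖S.V x‖]

/-- The summand `1` keeps the radicand positive, so the square root is as smooth as `B` and `V`,
even at their zeros. -/
theorem contDiffOn_m : ContDiffOn ℝ 1 S.m S.Ω := by
  have h : ContDiffOn ℝ 1 (fun x => 1 + (∑ j, ∑ k, S.B j k x ^ 2) + ‖S.V x‖ ^ 2) S.Ω :=
    (contDiffOn_const.add (ContDiffOn.sum fun j _ => ContDiffOn.sum fun k _ =>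
      (S.contDiffOn_B j k).pow 2)).add (S.V_reg.1.norm_sq ℝ)
  refine (h.sqrt fun x _ => ?_).congr fun x _ => by rw [m, normB_sq]
  have := S.normB_sq x
  positivity

theorem contDiffOn_Phi : ContDiffOn ℝ 1 S.Phi S.Ω :=
  (Complex.imCLM.contDiff.comp_contDiffOn S.V_reg.1).div S.contDiffOn_m
    fun x _ => (S.m_pos x).ne'

theorem contDiffOn_Psi (j k : Fin d) : ContDiffOn ℝ 1 (S.Psi j k) S.Ω :=
  (S.contDiffOn_B j k).div S.contDiffOn_m fun x _ => (S.m_pos x).ne'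

theorem abs_Phi_le (x : Space d) : |S.Phi x| ≤ 1 := by
  rw [Phi, abs_div, abs_of_pos (S.m_pos x), div_le_one (S.m_pos x)]
  exact (Complex.abs_im_le_norm _).trans (S.norm_V_le_m x)

theorem abs_Psi_le (j k : Fin d) (x : Space d) : |S.Psi j k x| ≤ 1 := by
  rw [Psi, abs_div, abs_of_pos (S.m_pos x), div_le_one (S.m_pos x)]
  exact S.abs_B_le_m j k x

variable {S}

/-- The derivative of a `C¹` function is continuous in `Ω`. -/
theorem continuousOn_fderiv_basisVec {F : Type*} [NormedAddCommGroup F] [NormedSpace ℝ F]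
    {f : Space d → F} (hf : ContDiffOn ℝ 1 f S.Ω) (j : Fin d) :
    ContinuousOn (fun x => fderiv ℝ f x (basisVec j)) S.Ω :=
  (hf.continuousOn_fderiv_of_isOpen S.isOpen le_rfl).clm_apply continuousOn_const

theorem differentiableAt_of_mem {F : Type*} [NormedAddCommGroup F] [NormedSpace ℝ F]
    {f : Space d → F} (hf : ContDiffOn ℝ 1 f S.Ω) {x : Space d} (hx : x ∈ S.Ω) :
    DifferentiableAt ℝ f x :=
  (hf.differentiableOn (by simp)).differentiableAt (S.isOpen.mem_nhds hx)

end ScalarRegularity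

theorem norm_gradient_sq (f : Space d → ℝ) (x : Space d) :
    ‖gradient f x‖ ^ 2 = ∑ j, (fderiv ℝ f x (basisVec j)) ^ 2 := by
  rw [EuclideanSpace.norm_sq_eq]
  refine Finset.sum_congr rfl fun j _ => ?_
  have h : inner ℝ (gradient f x) (basisVec j) = fderiv ℝ f x (basisVec j) := by
    rw [gradient, InnerProductSpace.toDual_symm_apply]
  rw [← h, basisVec, EuclideanSpace.inner_single_right]
  simp

/-! ### Compactly supported `C¹` functions and the variational norm -/

variable (S : Potentials d)

/-- The space `C¹_0(Ω)` of `C¹` functions with compact support in `Ω`. -/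
def compactC1 : Submodule ℂ (Space d → ℂ) where
  carrier := {f | ContDiff ℝ 1 f ∧ HasCompactSupport f ∧ tsupport f ⊆ S.Ω}
  zero_mem' := ⟨contDiff_const, HasCompactSupport.zero, by simp [tsupport]⟩
  add_mem' := fun {f g} h h' => ⟨h.1.add h'.1, h.2.1.add h'.2.1,
    (tsupport_add f g).trans (Set.union_subset h.2.2 h'.2.2)⟩
  smul_mem' := fun c f h => ⟨contDiff_const.smul h.1,
    h.2.1.mono (Function.support_const_smul_subset c f),
    (closure_mono (Function.support_const_smul_subset c f)).trans h.2.2⟩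

variable {S}

theorem IsTestFunction.mem_compactC1 {φ : Space d → ℂ} (h : S.IsTestFunction φ) :
    φ ∈ S.compactC1 :=
  ⟨h.smooth.of_le (by exact_mod_cast le_top), h.compact, h.subset⟩

/-- A function continuous in `Ω` that vanishes off the support of an element of `C¹_0(Ω)` is
continuous with compact support. -/
theorem continuous_of_eq_zero {F : Type*} [TopologicalSpace F] [Zero F] {f : Space d → ℂ}
    (hf : f ∈ S.compactC1) {g : Space d → F} (hg : ContinuousOn g S.Ω)
    (h0 : ∀ x, x ∉ tsupport f → g x = 0) : Continuous g ∧ HasCompactSupport g := by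
  have hs : tsupport g ⊆ tsupport f :=
    closure_minimal (fun x hx => by_contra fun h => hx (h0 x h)) (isClosed_tsupport f)
  exact ⟨hg.continuous_of_tsupport_subset S.isOpen (hs.trans hf.2.2),
    hf.2.1.of_isClosed_subset (isClosed_tsupport g) hs⟩

theorem memLp_of_eq_zero {f : Space d → ℂ} (hf : f ∈ S.compactC1) {g : Space d → ℂ}
    (hg : ContinuousOn g S.Ω) (h0 : ∀ x, x ∉ tsupport f → g x = 0) :
    MemLp g 2 (volume.restrict S.Ω) :=
  have h := continuous_of_eq_zero hf hg h0
  (h.1.memLp_of_hasCompactSupport h.2).restrict _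

theorem integrableOn_of_eq_zero {F : Type*} [NormedAddCommGroup F] {f : Space d → ℂ}
    (hf : f ∈ S.compactC1) {g : Space d → F} (hg : ContinuousOn g S.Ω)
    (h0 : ∀ x, x ∉ tsupport f → g x = 0) : IntegrableOn g S.Ω :=
  have h := continuous_of_eq_zero hf hg h0
  (h.1.integrable_of_hasCompactSupport h.2).integrableOn

theorem fderiv_eq_zero_of_notMem_tsupport {f : Space d → ℂ} {x : Space d}
    (hx : x ∉ tsupport f) : fderiv ℝ f x = 0 := by
  have := mt (fun h => support_fderiv_subset ℝ h) hx
  simpa using this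

variable (S)

/-- The components `f`, `|V|^{1/2} f`, `(-i∂_j + A_j) f` that determine the variational norm. -/
def component (f : Space d → ℂ) : Option (Option (Fin d)) → Space d → ℂ
  | none => f
  | some none => fun x => ((Real.sqrt ‖S.V x‖ : ℝ) : ℂ) * f x
  | some (some j) => fun x => -Complex.I * fderiv ℝ f x (basisVec j) + (S.A x j : ℂ) * f x

theorem component_none (f : Space d → ℂ) (x : Space d) : S.component f none x = f x := rfl

theorem component_some_none (f : Space d → ℂ) (x : Space d) :
    S.component f (some none) x = ((Real.sqrt ‖S.V x‖ : ℝ) : ℂ) * f x := rfl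

theorem component_some_some (f : Space d → ℂ) (j : Fin d) (x : Space d) :
    S.component f (some (some j)) x
      = -Complex.I * fderiv ℝ f x (basisVec j) + (S.A x j : ℂ) * f x := rfl

theorem continuousOn_sqrt_V : ContinuousOn (fun x => ((Real.sqrt ‖S.V x‖ : ℝ) : ℂ)) S.Ω :=
  (Complex.continuous_ofReal.comp Real.continuous_sqrt).comp_continuousOn S.continuousOn_V.norm

variable {S}

theorem component_eq_zero {f : Space d → ℂ} {x : Space d} (hx : x ∉ tsupport f)
    (i : Option (Option (Fin d))) : S.component f i x = 0 := by
  have h1 := image_eq_zero_of_notMem_tsupport hx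
  have h2 := fderiv_eq_zero_of_notMem_tsupport hx
  match i with
  | none => exact h1
  | some none => simp [component, h1]
  | some (some j) => simp [component, h1, h2]

theorem continuousOn_component {f : Space d → ℂ} (hf : f ∈ S.compactC1)
    (i : Option (Option (Fin d))) : ContinuousOn (S.component f i) S.Ω := by
  have h1 : ContinuousOn f S.Ω := hf.1.continuous.continuousOn
  match i with
  | none => exact h1
  | some none => exact S.continuousOn_sqrt_V.mul h1
  | some (some j) =>
    exact (continuousOn_const.mul (continuousOn_fderiv_basisVec hf.1.contDiffOn j)).add
      ((S.continuousOn_A j).mul h1)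

theorem memLp_component {f : Space d → ℂ} (hf : f ∈ S.compactC1)
    (i : Option (Option (Fin d))) : MemLp (S.component f i) 2 (volume.restrict S.Ω) :=
  memLp_of_eq_zero hf (continuousOn_component hf i) fun _ hx => component_eq_zero hx i

theorem component_add {f g : Space d → ℂ} (hf : f ∈ S.compactC1) (hg : g ∈ S.compactC1)
    (i : Option (Option (Fin d))) :
    S.component (f + g) i = S.component f i + S.component g i := by
  funext x
  match i with
  | none => rfl
  | some none => simp [component]; ring
  | some (some j) =>
    simp only [component, Pi.add_apply]
    rw [fderiv_add (hf.1.differentiable (by simp) x) (hg.1.differentiable (by simp) x),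
      add_apply]
    ring

theorem component_smul {f : Space d → ℂ} (hf : f ∈ S.compactC1) (c : ℂ)
    (i : Option (Option (Fin d))) : S.component (c • f) i = c • S.component f i := by
  funext x
  match i with
  | none => rfl
  | some none => simp [component]; ring
  | some (some j) =>
    simp only [component, Pi.smul_apply]
    rw [fderiv_const_smul (hf.1.differentiable (by simp) x), smul_apply]
    simp only [smul_eq_mul]
    ring

variable (S)

/-- The space `L²(Ω)^{d+2}` that contains the triples `(u, |V|^{1/2} u, (-i∇ + A) u)`. -/
abbrev GraphSpace : Type := PiLp 2 (fun _ : Option (Option (Fin d)) => S.H)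

/-- The map `f ↦ (f, |V|^{1/2} f, (-i∇ + A) f)` on `C¹_0(Ω)`. -/
def graphMap : S.compactC1 →ₗ[ℂ] S.GraphSpace where
  toFun f := WithLp.toLp 2 fun i => (memLp_component f.2 i).toLp _
  map_add' f g := by
    ext1 i
    have h := component_add f.2 g.2 i
    change MemLp.toLp (S.component (f + g : Space d → ℂ) i) (memLp_component (f + g).2 i)
      = MemLp.toLp _ (memLp_component f.2 i) + MemLp.toLp _ (memLp_component g.2 i)
    rw [← MemLp.toLp_add]
    exact MemLp.toLp_congr _ _ (by rw [h])
  map_smul' c f := by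
    ext1 i
    have h := component_smul f.2 c i
    change MemLp.toLp (S.component (c • f : Space d → ℂ) i) (memLp_component (c • f).2 i)
      = c • MemLp.toLp _ (memLp_component f.2 i)
    rw [← MemLp.toLp_const_smul]
    exact MemLp.toLp_congr _ _ (by rw [h])

variable {S}

theorem graphMap_apply (f : S.compactC1) (i : Option (Option (Fin d))) :
    S.graphMap f i = (memLp_component f.2 i).toLp _ := rfl

theorem coeFn_graphMap (f : S.compactC1) (i : Option (Option (Fin d))) :
    S.graphMap f i =ᵐ[volume.restrict S.Ω] S.component f i :=
  (memLp_component f.2 i).coeFn_toLp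

theorem inner_eq_integral (u v : S.H) : inner ℂ u v = ∫ x in S.Ω, v x * conj (u x) := by
  rw [L2.inner_def]
  rfl

theorem inner_toLp {f g : Space d → ℂ} (hf : MemLp f 2 (volume.restrict S.Ω))
    (hg : MemLp g 2 (volume.restrict S.Ω)) :
    inner ℂ (hf.toLp f : S.H) (hg.toLp g) = ∫ x in S.Ω, g x * conj (f x) := by
  rw [inner_eq_integral]
  refine integral_congr_ae ?_
  filter_upwards [hf.coeFn_toLp, hg.coeFn_toLp] with x h1 h2
  rw [h1, h2]

theorem norm_sq_eq_integral (u : S.H) : ‖u‖ ^ 2 = ∫ x in S.Ω, ‖u x‖ ^ 2 := by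
  have h : ((‖u‖ ^ 2 : ℝ) : ℂ) = ((∫ x in S.Ω, ‖u x‖ ^ 2 : ℝ) : ℂ) := by
    rw [← integral_complex_ofReal, Complex.ofReal_pow]
    refine (inner_self_eq_norm_sq_to_K (𝕜 := ℂ) u).symm.trans ?_
    rw [inner_eq_integral]
    refine integral_congr_ae (Filter.Eventually.of_forall fun x => ?_)
    simp [Complex.mul_conj, Complex.normSq_eq_norm_sq]
  exact_mod_cast h

theorem norm_toLp_sq {f : Space d → ℂ} (hf : MemLp f 2 (volume.restrict S.Ω)) :
    ‖(hf.toLp f : S.H)‖ ^ 2 = ∫ x in S.Ω, ‖f x‖ ^ 2 := by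
  rw [norm_sq_eq_integral]
  refine integral_congr_ae ?_
  filter_upwards [hf.coeFn_toLp] with x h1
  rw [h1]

variable (S)

/-- The density of the squared magnetic gradient. -/
def gradSq (f : Space d → ℂ) (x : Space d) : ℝ := ∑ j, ‖S.component f (some (some j)) x‖ ^ 2

/-- The density of the squared variational norm. -/
def energy (f : Space d → ℂ) (x : Space d) : ℝ :=
  ‖f x‖ ^ 2 + ‖S.V x‖ * ‖f x‖ ^ 2 + S.gradSq f x

variable {S}

theorem gradSq_nonneg (f : Space d → ℂ) (x : Space d) : 0 ≤ S.gradSq f x :=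
  Finset.sum_nonneg fun _ _ => sq_nonneg _

theorem continuousOn_gradSq {f : Space d → ℂ} (hf : f ∈ S.compactC1) :
    ContinuousOn (S.gradSq f) S.Ω :=
  continuousOn_finsetSum _ fun _ _ => (continuousOn_component hf _).norm.pow 2

theorem gradSq_eq_zero {f : Space d → ℂ} {x : Space d} (hx : x ∉ tsupport f) :
    S.gradSq f x = 0 :=
  Finset.sum_eq_zero fun j _ => by simp [component_eq_zero hx (some (some j))]

theorem norm_graphMap_sq (f : S.compactC1) :
    ‖S.graphMap f‖ ^ 2 = ∫ x in S.Ω, S.energy f x := by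
  have hi (i : Option (Option (Fin d))) :
      IntegrableOn (fun x => ‖S.component f i x‖ ^ 2) S.Ω :=
    integrableOn_of_eq_zero f.2 ((continuousOn_component f.2 i).norm.pow 2)
      fun x hx => by simp [component_eq_zero hx i]
  rw [PiLp.norm_sq_eq_of_L2]
  simp only [graphMap_apply, norm_toLp_sq]
  rw [← integral_finsetSum _ fun i _ => hi i]
  congr 1
  funext x
  rw [Fintype.sum_option, Fintype.sum_option, energy, gradSq, component_none,
    component_some_none, norm_mul, mul_pow, Complex.norm_real, Real.norm_eq_abs,
    sq_abs, Real.sq_sqrt (norm_nonneg _), add_assoc]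

/-! ### Density of the test functions -/

/-- On functions supported in a fixed compact subset of `Ω`, the variational norm is controlled by
the `C¹` norm. -/
theorem exists_norm_graphMap_le {K : Set (Space d)} (hK : IsCompact K) (hKΩ : K ⊆ S.Ω) :
    ∃ C : ℝ, ∀ (f : S.compactC1) (ε : ℝ), 0 ≤ ε → tsupport (f : Space d → ℂ) ⊆ K →
      (∀ x, ‖(f : Space d → ℂ) x‖ ≤ ε) →
      (∀ x j, ‖fderiv ℝ (f : Space d → ℂ) x (basisVec j)‖ ≤ ε) →
      ‖S.graphMap f‖ ^ 2 ≤ C * ε ^ 2 := by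
  have hw : ContinuousOn (fun x => 1 + ‖S.V x‖ + ∑ j, (1 + ‖(S.A x j : ℂ)‖) ^ 2) S.Ω :=
    (continuousOn_const.add S.continuousOn_V.norm).add
      (continuousOn_finsetSum _ fun j _ => (continuousOn_const.add (S.continuousOn_A j).norm).pow 2)
  obtain ⟨M, hM⟩ := hK.exists_bound_of_continuousOn (hw.mono hKΩ)
  -- `M` bounds on `K` the weight `1 + |V| + ∑ (1 + |A_j|)²`, so the energy density is at most `Mε²`
  -- on `K` and zero elsewhere.
  refine ⟨M * volume.real K, fun f ε hε hf h0 h1 => ?_⟩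
  have hbound : ∀ x ∈ K, ‖S.energy f x‖ ≤ M * ε ^ 2 := by
    intro x hx
    have hx0 := h0 x
    have hg : S.gradSq f x ≤ ∑ j, ((1 + ‖(S.A x j : ℂ)‖) ^ 2 * ε ^ 2) := by
      refine Finset.sum_le_sum fun j _ => ?_
      rw [← mul_pow]
      refine pow_le_pow_left₀ (norm_nonneg _) ?_ 2
      rw [component_some_some]
      refine (norm_add_le _ _).trans ?_
      rw [norm_mul, norm_mul, norm_neg, Complex.norm_I, one_mul, add_mul, one_mul]
      exact add_le_add (h1 x j) (mul_le_mul_of_nonneg_left hx0 (norm_nonneg _))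
    rw [← Finset.sum_mul] at hg
    have hsq : ‖(f : Space d → ℂ) x‖ ^ 2 ≤ ε ^ 2 := pow_le_pow_left₀ (norm_nonneg _) hx0 2
    have he : 0 ≤ S.energy f x := by
      have := S.gradSq_nonneg f x
      rw [energy]
      positivity
    rw [Real.norm_of_nonneg he, energy]
    have h2 := mul_le_mul_of_nonneg_left hsq (norm_nonneg (S.V x))
    have h3 := mul_le_mul_of_nonneg_right ((le_abs_self _).trans (hM x hx)) (sq_nonneg ε)
    linarith
  have hsupp : ∀ x, x ∉ K → S.energy f x = 0 := by
    intro x hx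
    have hx' : x ∉ tsupport (f : Space d → ℂ) := fun h => hx (hf h)
    simp [energy, gradSq_eq_zero hx', image_eq_zero_of_notMem_tsupport hx']
  rw [norm_graphMap_sq, setIntegral_eq_integral_of_forall_compl_eq_zero
    (fun x hx => hsupp x fun h => hx (hKΩ h)),
    ← setIntegral_eq_integral_of_forall_compl_eq_zero (s := K) hsupp]
  refine (le_abs_self _).trans ((norm_setIntegral_le_of_norm_le_const hK.measure_lt_top
    hbound).trans (le_of_eq ?_))
  ring

/-- Test functions are dense in `C¹_0(Ω)` for the variational norm. -/
theorem graphMap_mem_closure (f : S.compactC1) :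
    S.graphMap f ∈ closure (S.graphMap '' {φ | S.IsTestFunction φ}) := by
  obtain ⟨hf1, hfc, hfs⟩ := f.2
  set F : Space d → ℂ := (f : Space d → ℂ)
  obtain ⟨δ, hδ, hδΩ⟩ := hfc.isCompact.exists_cthickening_subset_open S.isOpen hfs
  have hK : IsCompact (Metric.cthickening δ (tsupport F)) := hfc.isCompact.cthickening
  obtain ⟨C, hC⟩ := exists_norm_graphMap_le hK hδΩ
  have hDc : Continuous (fderiv ℝ F) := hf1.continuous_fderiv (by simp)
  have hu := hfc.uniformContinuous_of_continuous hf1.continuous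
  have hu' := (hfc.fderiv ℝ).uniformContinuous_of_continuous hDc
  rw [Metric.mem_closure_iff]
  intro η hη
  obtain ⟨ε, hε, hεη⟩ : ∃ ε : ℝ, 0 < ε ∧ C * ε ^ 2 < η ^ 2 := by
    -- No sign of `C` is known; this choice works because `C < (|C| + 1)²`.
    refine ⟨η / (|C| + 1), by positivity, ?_⟩
    have hC1 : 0 < |C| + 1 := by positivity
    rw [div_pow, ← mul_div_assoc, div_lt_iff₀ (by positivity), mul_comm]
    refine mul_lt_mul_of_pos_left ?_ (by positivity)
    nlinarith [le_abs_self C, abs_nonneg C]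
  obtain ⟨δ₁, hδ₁, h1⟩ := Metric.uniformContinuous_iff.1 hu ε hε
  obtain ⟨δ₂, hδ₂, h2⟩ := Metric.uniformContinuous_iff.1 hu' ε hε
  -- The mollification radius: `δ` keeps the support in the compact thickening inside `Ω`, while
  -- `δ₁` and `δ₂` are moduli of uniform continuity of `F` and of its derivative.
  set r := min δ (min δ₁ δ₂) with hr
  have hrpos : 0 < r := lt_min hδ (lt_min hδ₁ hδ₂)
  let b : ContDiffBump (0 : Space d) := ⟨r / 2, r, by positivity, by linarith⟩
  set φ : Space d → ℂ := convolution (b.normed volume) F (ContinuousLinearMap.lsmul ℝ ℝ) volume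
    with hφ
  have hloc : LocallyIntegrable (b.normed volume) :=
    (b.continuous_normed).locallyIntegrable
  have hφs : ContDiff ℝ ∞ φ := b.hasCompactSupport_normed.contDiff_convolution_left _
    b.contDiff_normed hf1.continuous.locallyIntegrable
  have hφt : tsupport φ ⊆ Metric.cthickening δ (tsupport F) := by
    refine closure_minimal ?_ Metric.isClosed_cthickening
    refine (support_convolution_subset _).trans ?_
    rintro _ ⟨y, hy, z, hz, rfl⟩
    rw [b.support_normed_eq, Metric.mem_ball, dist_zero_right] at hy
    refine Metric.mem_cthickening_of_dist_le _ z _ _ (subset_tsupport _ hz) ?_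
    have h3 : ‖y‖ < r := hy
    simpa [dist_eq_norm] using h3.le.trans (min_le_left _ _)
  have hφtest : S.IsTestFunction φ :=
    ⟨hφs, hK.of_isClosed_subset (isClosed_tsupport _) hφt, hφt.trans hδΩ⟩
  -- The derivative falls on `F`, so `∂_j φ` is the mollification of `∂_j F` and is uniformly close
  -- to it.
  have hφd (x : Space d) (j : Fin d) : fderiv ℝ φ x (basisVec j)
      = convolution (b.normed volume) (fun a => fderiv ℝ F a (basisVec j))
        (ContinuousLinearMap.lsmul ℝ ℝ) volume x := by
    rw [(hfc.hasFDerivAt_convolution_right (ContinuousLinearMap.lsmul ℝ ℝ) hloc hf1 x).fderiv]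
    exact convolution_precompR_apply _ hloc (hfc.fderiv ℝ) hDc x _
  refine ⟨S.graphMap ⟨φ, hφtest.mem_compactC1⟩, ⟨_, hφtest, rfl⟩, ?_⟩
  rw [dist_comm, dist_eq_norm, ← map_sub]
  refine lt_of_pow_lt_pow_left₀ 2 hη.le ((hC _ ε hε.le ?_ ?_ ?_).trans_lt hεη)
  · refine (tsupport_sub _ _).trans (Set.union_subset hφt ?_)
    exact Metric.self_subset_cthickening _
  · intro x
    change ‖φ x - F x‖ ≤ ε
    rw [← dist_eq_norm]
    refine b.dist_normed_convolution_le hf1.continuous.aestronglyMeasurable fun y hy => ?_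
    exact (h1 (lt_of_lt_of_le hy ((min_le_right _ _).trans (min_le_left _ _)))).le
  · intro x j
    have h3 : fderiv ℝ (φ - F) x = fderiv ℝ φ x - fderiv ℝ F x :=
      fderiv_sub (hφs.differentiable (by simp) x) (hf1.differentiable (by simp) x)
    change ‖fderiv ℝ (φ - F) x (basisVec j)‖ ≤ ε
    rw [h3, sub_apply, hφd, ← dist_eq_norm]
    refine b.dist_normed_convolution_le
      (hDc.clm_apply continuous_const).aestronglyMeasurable fun y hy => ?_
    rw [dist_eq_norm, ← sub_apply]
    refine (ContinuousLinearMap.le_opNorm _ _).trans ?_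
    have h4 : ‖(basisVec j : Space d)‖ = 1 := by simp [basisVec]
    rw [h4, mul_one, ← dist_eq_norm]
    exact (h2 (lt_of_lt_of_le hy ((min_le_right _ _).trans (min_le_right _ _)))).le

/-! ### Product rule, integration by parts and the magnetic commutator -/

theorem mul_mem_compactC1 {g f : Space d → ℂ} (hg : ContDiffOn ℝ 1 g S.Ω)
    (hf : f ∈ S.compactC1) : (fun x => g x * f x) ∈ S.compactC1 := by
  have hs : tsupport (fun x => g x * f x) ⊆ tsupport f := tsupport_mul_subset_right
  refine ⟨contDiff_iff_contDiffAt.2 fun x => ?_, hf.2.1.mul_left, hs.trans hf.2.2⟩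
  by_cases hx : x ∈ tsupport f
  · exact (hg.contDiffAt (S.isOpen.mem_nhds (hf.2.2 hx))).mul hf.1.contDiffAt
  · have h0 : (fun x => g x * f x) =ᶠ[nhds x] fun _ => 0 := by
      filter_upwards [(isClosed_tsupport f).isOpen_compl.mem_nhds hx] with y hy
      simp [image_eq_zero_of_notMem_tsupport hy]
    exact contDiffAt_const.congr_of_eventuallyEq h0

theorem component_mul {g f : Space d → ℂ} (hg : ContDiffOn ℝ 1 g S.Ω) (hf : f ∈ S.compactC1)
    (j : Fin d) {x : Space d} (hx : x ∈ S.Ω) :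
    S.component (fun y => g y * f y) (some (some j)) x
      = g x * S.component f (some (some j)) x
        - Complex.I * fderiv ℝ g x (basisVec j) * f x := by
  have h : fderiv ℝ (fun y => g y * f y) x = g x • fderiv ℝ f x + f x • fderiv ℝ g x :=
    fderiv_fun_mul (differentiableAt_of_mem hg hx) (hf.1.differentiable (by simp) x)
  rw [component_some_some, component_some_some, h, add_apply,
    smul_apply, smul_apply, smul_eq_mul, smul_eq_mul]
  ring

/-- Each component of the magnetic gradient is formally self-adjoint. -/
theorem integral_component_mul_conj {f h : Space d → ℂ} (hf : f ∈ S.compactC1)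
    (hh : h ∈ S.compactC1) (j : Fin d) :
    ∫ x in S.Ω, S.component f (some (some j)) x * conj (h x)
      = ∫ x in S.Ω, f x * conj (S.component h (some (some j)) x) := by
  have hc : ContDiff ℝ 1 fun x => conj (h x) := Complex.conjCLE.contDiff.comp hh.1
  have hD (x : Space d) : fderiv ℝ (fun x => conj (h x)) x (basisVec j)
      = conj (fderiv ℝ h x (basisVec j)) := by
    have h1 : HasFDerivAt (fun x => conj (h x))
        ((Complex.conjCLE : ℂ →L[ℝ] ℂ).comp (fderiv ℝ h x)) x :=
      (Complex.conjCLE : ℂ →L[ℝ] ℂ).hasFDerivAt.comp x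
        (hh.1.differentiable (by simp) x).hasFDerivAt
    rw [h1.fderiv]
    rfl
  have cf := (hf.1.continuous_fderiv (by simp)).clm_apply
    (continuous_const (y := (basisVec j : Space d)))
  have ch := (hh.1.continuous_fderiv (by simp)).clm_apply
    (continuous_const (y := (basisVec j : Space d)))
  have i1 : Integrable (fun x => fderiv ℝ f x (basisVec j) * conj (h x)) :=
    (cf.mul hc.continuous).integrable_of_hasCompactSupport
      ((hf.2.1.fderiv_apply ℝ (basisVec j)).mul_right)
  have i2 : Integrable (fun x => f x * fderiv ℝ (fun x => conj (h x)) x (basisVec j)) := by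
    simp only [hD]
    exact (hf.1.continuous.mul (Complex.continuous_conj.comp ch)).integrable_of_hasCompactSupport
      hf.2.1.mul_right
  have i3 : Integrable (fun x => f x * conj (h x)) :=
    (hf.1.continuous.mul hc.continuous).integrable_of_hasCompactSupport hf.2.1.mul_right
  have i4 : IntegrableOn (fun x => (S.A x j : ℂ) * f x * conj (h x)) S.Ω :=
    integrableOn_of_eq_zero hf (((S.continuousOn_A j).mul hf.1.continuous.continuousOn).mul
      hc.continuous.continuousOn) fun x hx => by simp [image_eq_zero_of_notMem_tsupport hx]
  have ibp := integral_mul_fderiv_eq_neg_fderiv_mul_of_integrable (μ := volume)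
    (v := basisVec j) i1 i2 i3 (fun x _ => hf.1.differentiable (by simp) x)
    (fun x _ => hc.differentiable (by simp) x)
  have r1 : ∫ x in S.Ω, fderiv ℝ f x (basisVec j) * conj (h x)
      = ∫ x, fderiv ℝ f x (basisVec j) * conj (h x) := by
    refine setIntegral_eq_integral_of_forall_compl_eq_zero fun x hx => ?_
    rw [image_eq_zero_of_notMem_tsupport fun h' => hx (hh.2.2 h'), map_zero, mul_zero]
  have r2 : ∫ x in S.Ω, f x * fderiv ℝ (fun x => conj (h x)) x (basisVec j)
      = ∫ x, f x * fderiv ℝ (fun x => conj (h x)) x (basisVec j) := by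
    refine setIntegral_eq_integral_of_forall_compl_eq_zero fun x hx => ?_
    rw [image_eq_zero_of_notMem_tsupport fun h' => hx (hf.2.2 h'), zero_mul]
  have e1 : ∫ x in S.Ω, S.component f (some (some j)) x * conj (h x)
      = ∫ x in S.Ω, ((-Complex.I) * (fderiv ℝ f x (basisVec j) * conj (h x))
        + (S.A x j : ℂ) * f x * conj (h x)) := by
    congr 1; funext x; rw [component_some_some]; ring
  have e2 : ∫ x in S.Ω, f x * conj (S.component h (some (some j)) x)
      = ∫ x in S.Ω, (Complex.I * (f x * fderiv ℝ (fun x => conj (h x)) x (basisVec j))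
        + (S.A x j : ℂ) * f x * conj (h x)) := by
    congr 1; funext x
    rw [component_some_some, hD]
    simp only [map_add, map_mul, map_neg, Complex.conj_I, Complex.conj_ofReal]
    ring
  rw [e1, e2, integral_add ((i1.integrableOn (s := S.Ω)).const_mul (-Complex.I)) i4,
    integral_add ((i2.integrableOn (s := S.Ω)).const_mul Complex.I) i4,
    integral_const_mul, integral_const_mul, r1, r2, ibp]
  ring

theorem contDiffOn_A_ofReal (j : Fin d) : ContDiffOn ℝ 1 (fun x => (S.A x j : ℂ)) S.Ω :=
  Complex.ofRealCLM.contDiff.comp_contDiffOn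
    ((EuclideanSpace.proj (𝕜 := ℝ) j).contDiff.comp_contDiffOn (S.A_reg.1.of_le (by norm_num)))

theorem fderiv_ofReal_comp {g : Space d → ℝ} {x : Space d} (hg : DifferentiableAt ℝ g x)
    (v : Space d) : fderiv ℝ (fun y => (g y : ℂ)) x v = (fderiv ℝ g x v : ℂ) := by
  have h : HasFDerivAt (fun y => (g y : ℂ)) (Complex.ofRealCLM.comp (fderiv ℝ g x)) x :=
    Complex.ofRealCLM.hasFDerivAt.comp x hg.hasFDerivAt
  rw [h.fderiv]
  rfl

theorem fderiv_A_ofReal (j k : Fin d) {x : Space d} (hx : x ∈ S.Ω) :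
    fderiv ℝ (fun y => (S.A y k : ℂ)) x (basisVec j)
      = ((fderiv ℝ S.A x (basisVec j)) k : ℂ) := by
  have hA : DifferentiableAt ℝ S.A x :=
    differentiableAt_of_mem (S.A_reg.1.of_le (by norm_num)) hx
  have h : HasFDerivAt (fun y => S.A y k)
      ((EuclideanSpace.proj (𝕜 := ℝ) k : Space d →L[ℝ] ℝ).comp (fderiv ℝ S.A x)) x :=
    (EuclideanSpace.proj (𝕜 := ℝ) k : Space d →L[ℝ] ℝ).hasFDerivAt.comp x hA.hasFDerivAt
  rw [fderiv_ofReal_comp h.differentiableAt, h.fderiv]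
  rfl

theorem IsTestFunction.component_mem {φ : Space d → ℂ} (hφ : S.IsTestFunction φ) (k : Fin d) :
    S.component φ (some (some k)) ∈ S.compactC1 := by
  have h1 : (fun x => fderiv ℝ φ x (basisVec k)) ∈ S.compactC1 := by
    refine ⟨?_, hφ.fderiv_compact k, (tsupport_fderiv_apply_subset ℝ _).trans hφ.subset⟩
    exact (hφ.smooth.fderiv_right (m := 1) (by norm_cast)).clm_apply contDiff_const
  exact S.compactC1.add_mem (S.compactC1.smul_mem (-Complex.I) h1)
    (mul_mem_compactC1 (contDiffOn_A_ofReal k) hφ.mem_compactC1)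

/-- The commutator `[P_j, P_k] = -i B_{jk}` of the components of `P = -i∇ + A`. -/
theorem IsTestFunction.commutator {φ : Space d → ℂ} (hφ : S.IsTestFunction φ) (j k : Fin d)
    {x : Space d} (hx : x ∈ S.Ω) :
    S.component (S.component φ (some (some k))) (some (some j)) x
      - S.component (S.component φ (some (some j))) (some (some k)) x
      = -Complex.I * ((S.B j k x : ℂ) * φ x) := by
  have hdiff : DifferentiableAt ℝ (fderiv ℝ φ) x :=
    ((hφ.smooth.fderiv_right (m := 1) (by norm_cast)).differentiable (by simp)) x
  have hfd (j k : Fin d) : fderiv ℝ (S.component φ (some (some k))) x (basisVec j)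
      = -Complex.I * fderiv ℝ (fderiv ℝ φ) x (basisVec j) (basisVec k)
        + (((fderiv ℝ S.A x (basisVec j)) k : ℂ) * φ x
          + (S.A x k : ℂ) * fderiv ℝ φ x (basisVec j)) := by
    have h1 : HasFDerivAt (fun y => -Complex.I * fderiv ℝ φ y (basisVec k))
        ((-Complex.I) • ((fderiv ℝ (fderiv ℝ φ) x).flip (basisVec k))) x := by
      refine HasFDerivAt.const_mul ?_ _
      have := hdiff.hasFDerivAt.clm_apply (hasFDerivAt_const (basisVec k) x)
      simpa using this
    have h2 := (differentiableAt_of_mem (contDiffOn_A_ofReal k) hx).hasFDerivAt.mul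
      (hφ.smooth.differentiable (by simp) x).hasFDerivAt
    have h3 : HasFDerivAt (S.component φ (some (some k))) _ x := h1.add h2
    rw [h3.fderiv, ← fderiv_A_ofReal j k hx]
    simp
    ring
  -- The second derivatives of `φ` cancel by symmetry, the first-order terms cancel in pairs, and
  -- only the derivatives of `A` survive.
  have hsymm : fderiv ℝ (fderiv ℝ φ) x (basisVec j) (basisVec k)
      = fderiv ℝ (fderiv ℝ φ) x (basisVec k) (basisVec j) :=
    (hφ.smooth.contDiffAt.isSymmSndFDerivAt
      (by rw [minSmoothness_of_isRCLikeNormedField, ← one_add_one_eq_two]; norm_cast)) _ _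
  rw [component_some_some _ (S.component φ (some (some k))),
    component_some_some _ (S.component φ (some (some j))), hfd, hfd, component_some_some,
    component_some_some, hsymm, B]
  push_cast
  ring_nf

/-- The weak form of the commutator identity. -/
theorem inner_graphMap_commutator (f h : S.compactC1) (j k : Fin d) :
    inner ℂ (S.graphMap h (some (some j))) (S.graphMap f (some (some k)))
      - inner ℂ (S.graphMap h (some (some k))) (S.graphMap f (some (some j)))
      = -Complex.I * ∫ x in S.Ω,
        (S.B j k x : ℂ) * ((f : Space d → ℂ) x * conj ((h : Space d → ℂ) x)) := by
  have hBc : ContinuousOn (fun x => (S.B j k x : ℂ)) S.Ω :=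
    Complex.continuous_ofReal.comp_continuousOn (S.contDiffOn_B j k).continuousOn
  have hB : MemLp (fun x => (S.B j k x : ℂ) * (h : Space d → ℂ) x) 2 (volume.restrict S.Ω) :=
    memLp_of_eq_zero h.2 (hBc.mul h.2.1.continuous.continuousOn)
      fun x hx => by simp [image_eq_zero_of_notMem_tsupport hx]
  -- The pointwise commutator needs two derivatives of the first function, which `f` does not have.
  -- For fixed `h` the weak identity involves only the components of the graph of `f`, continuously,
  -- so it passes from test functions to `f` by density. On `h` one integration by parts suffices.
  have hkey : S.graphMap f ∈ {y : S.GraphSpace |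
      inner ℂ (S.graphMap h (some (some j))) (y (some (some k)))
        - inner ℂ (S.graphMap h (some (some k))) (y (some (some j)))
        = -Complex.I * inner ℂ (hB.toLp _ : S.H) (y none)} := by
    refine closure_minimal ?_ (isClosed_eq ?_ ?_) (graphMap_mem_closure f)
    · rintro _ ⟨φ, hφ, rfl⟩
      change S.IsTestFunction φ at hφ
      have h1 (j k : Fin d) :
          inner ℂ (S.graphMap h (some (some j))) (S.graphMap φ (some (some k)))
          = ∫ x in S.Ω, S.component (S.component φ (some (some k))) (some (some j)) x
            * conj ((h : Space d → ℂ) x) := by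
        rw [integral_component_mul_conj (hφ.component_mem k) h.2 j, graphMap_apply,
          graphMap_apply, inner_toLp]
      have i1 (j k : Fin d) : IntegrableOn (fun x =>
          S.component (S.component φ (some (some k))) (some (some j)) x
            * conj ((h : Space d → ℂ) x)) S.Ω :=
        integrableOn_of_eq_zero h.2 ((continuousOn_component (hφ.component_mem k) _).mul
          (Complex.continuous_conj.comp h.2.1.continuous).continuousOn)
          fun x hx => by simp [image_eq_zero_of_notMem_tsupport hx]
      change _ - _ = -Complex.I * inner ℂ (hB.toLp _ : S.H) (S.graphMap φ none)
      rw [h1, h1, ← integral_sub (i1 j k) (i1 k j), graphMap_apply, inner_toLp,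
        ← integral_const_mul]
      refine setIntegral_congr_fun S.isOpen.measurableSet fun x hx => ?_
      have hc := hφ.commutator j k hx
      simp only [component_none, map_mul, Complex.conj_ofReal]
      rw [← sub_mul, hc]
      ring
    · fun_prop
    · fun_prop
  rw [Set.mem_ofPred_eq] at hkey
  rw [hkey, graphMap_apply, inner_toLp]
  congr 2
  funext x
  simp only [component_none, map_mul, Complex.conj_ofReal]
  ring

/-! ### The magnetic lower bound -/

theorem integrableOn_weight {f : Space d → ℂ} (hf : f ∈ S.compactC1) {w : Space d → ℝ}
    (hw : ContinuousOn w S.Ω) : IntegrableOn (fun x => w x * ‖f x‖ ^ 2) S.Ω :=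
  integrableOn_of_eq_zero hf (hw.mul (hf.1.continuous.norm.pow 2).continuousOn)
    fun x hx => by simp [image_eq_zero_of_notMem_tsupport hx]

theorem integrableOn_gradSq {f : Space d → ℂ} (hf : f ∈ S.compactC1) :
    IntegrableOn (S.gradSq f) S.Ω :=
  integrableOn_of_eq_zero hf (continuousOn_gradSq hf) fun _ hx => gradSq_eq_zero hx

theorem integrableOn_component_sq {f : Space d → ℂ} (hf : f ∈ S.compactC1)
    (i : Option (Option (Fin d))) : IntegrableOn (fun x => ‖S.component f i x‖ ^ 2) S.Ω :=
  integrableOn_of_eq_zero hf ((continuousOn_component hf i).norm.pow 2)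
    fun x hx => by simp [component_eq_zero hx i]

theorem continuousOn_gradient_sq {g : Space d → ℝ} (hg : ContDiffOn ℝ 1 g S.Ω) :
    ContinuousOn (fun x => ‖gradient g x‖ ^ 2) S.Ω := by
  simp only [norm_gradient_sq]
  exact continuousOn_finsetSum _ fun j _ => (continuousOn_fderiv_basisVec hg j).pow 2

theorem fderiv_sq_le_norm_gradient_sq (g : Space d → ℝ) (x : Space d) (j : Fin d) :
    fderiv ℝ g x (basisVec j) ^ 2 ≤ ‖gradient g x‖ ^ 2 := by
  rw [norm_gradient_sq]
  exact Finset.single_le_sum (f := fun j => fderiv ℝ g x (basisVec j) ^ 2)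
    (fun _ _ => sq_nonneg _) (Finset.mem_univ j)

theorem contDiffOn_ofReal {g : Space d → ℝ} (hg : ContDiffOn ℝ 1 g S.Ω) :
    ContDiffOn ℝ 1 (fun x => (g x : ℂ)) S.Ω :=
  Complex.ofRealCLM.contDiff.comp_contDiffOn hg

/-- The contribution of one entry of the magnetic matrix to the magnetic lower bound. -/
theorem integral_B_mul_Psi_le {f : Space d → ℂ} (hf : f ∈ S.compactC1) (j k : Fin d) :
    ∫ x in S.Ω, S.B j k x * S.Psi j k x * ‖f x‖ ^ 2
      ≤ ∫ x in S.Ω, (3 / 2 * (‖S.component f (some (some j)) x‖ ^ 2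
        + ‖S.component f (some (some k)) x‖ ^ 2) + ‖gradient (S.Psi j k) x‖ ^ 2 * ‖f x‖ ^ 2) := by
  have hΨ := contDiffOn_ofReal (S.contDiffOn_Psi j k)
  have hh := mul_mem_compactC1 hΨ hf
  set p := fun i => S.component f (some (some i)) with hp
  set q := fun i => S.component (fun y => (S.Psi j k y : ℂ) * f y) (some (some i)) with hq
  have hint (a b : Fin d) : IntegrableOn (fun x => p a x * conj (q b x)) S.Ω :=
    integrableOn_of_eq_zero hf ((continuousOn_component hf _).mul
      (Complex.continuous_conj.comp_continuousOn (continuousOn_component hh _)))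
      fun x hx => by simp [hp, component_eq_zero hx]
  have hcomm := inner_graphMap_commutator ⟨f, hf⟩ ⟨_, hh⟩ j k
  rw [graphMap_apply, graphMap_apply, graphMap_apply, graphMap_apply, inner_toLp, inner_toLp]
    at hcomm
  -- The weak commutator identity is tested with `h = Ψ_{jk} f`.
  have h2 : ((∫ x in S.Ω, S.B j k x * S.Psi j k x * ‖f x‖ ^ 2 : ℝ) : ℂ)
      = Complex.I * ∫ x in S.Ω, (p k x * conj (q j x) - p j x * conj (q k x)) := by
    rw [integral_sub (hint k j) (hint j k)]
    refine Eq.trans ?_ (congrArg (Complex.I * ·) hcomm.symm)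
    rw [← integral_complex_ofReal, ← mul_assoc, mul_neg, Complex.I_mul_I, neg_neg, one_mul]
    congr 1
    funext x
    simp only [map_mul, Complex.conj_ofReal]
    rw [show f x * ((S.Psi j k x : ℂ) * conj (f x))
      = (S.Psi j k x : ℂ) * (f x * conj (f x)) by ring,
      Complex.mul_conj, Complex.normSq_eq_norm_sq]
    push_cast
    ring
  refine (le_abs_self _).trans ?_
  rw [← Real.norm_eq_abs, ← Complex.norm_real, h2, norm_mul, Complex.norm_I, one_mul]
  refine norm_integral_le_of_norm_le ?_ ?_
  · exact (((integrableOn_component_sq hf _).add (integrableOn_component_sq hf _)).const_mul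
      _).add (integrableOn_weight hf (continuousOn_gradient_sq (S.contDiffOn_Psi j k)))
  · refine (ae_restrict_iff' S.isOpen.measurableSet).2 (Filter.Eventually.of_forall fun x hx => ?_)
    have hd := differentiableAt_of_mem (S.contDiffOn_Psi j k) hx
    -- The product rule and `|Ψ| ≤ 1` give `|q_b| ≤ |p_b| + |∂_bΨ||f|`; Young's inequality then
    -- splits `|p_a||∂_bΨ||f|` with equal weights `1/2`. The cases `(k, j)` and `(j, k)` add up to
    -- one full `|∇Ψ|²|f|²`, and `2|p_j||p_k| ≤ |p_j|² + |p_k|²` completes the factor `3/2`.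
    have hqn (a b : Fin d) : ‖p a x * conj (q b x)‖ ≤ ‖p a x‖ * ‖p b x‖
        + (1 / 2) * (‖p a x‖ ^ 2 + ‖gradient (S.Psi j k) x‖ ^ 2 * ‖f x‖ ^ 2) := by
      have h3 : ‖q b x‖ ≤ ‖p b x‖ + |fderiv ℝ (S.Psi j k) x (basisVec b)| * ‖f x‖ := by
        simp only [hq]
        rw [component_mul hΨ hf b hx, fderiv_ofReal_comp hd]
        refine (norm_sub_le _ _).trans (add_le_add ?_ (le_of_eq ?_))
        · rw [norm_mul, Complex.norm_real, Real.norm_eq_abs]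
          exact mul_le_of_le_one_left (norm_nonneg _) (S.abs_Psi_le j k x)
        · rw [norm_mul, norm_mul, Complex.norm_I, one_mul, Complex.norm_real, Real.norm_eq_abs]
      have h4 := fderiv_sq_le_norm_gradient_sq (S.Psi j k) x b
      rw [norm_mul, RCLike.norm_conj]
      have h5 := mul_le_mul_of_nonneg_left h3 (norm_nonneg (p a x))
      have h6 := mul_le_mul_of_nonneg_right h4 (sq_nonneg ‖f x‖)
      rw [← sq_abs (fderiv ℝ (S.Psi j k) x (basisVec b))] at h6
      nlinarith [sq_nonneg (‖p a x‖ - |fderiv ℝ (S.Psi j k) x (basisVec b)| * ‖f x‖)]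
    refine (norm_sub_le _ _).trans ((add_le_add (hqn k j) (hqn j k)).trans ?_)
    change _ ≤ 3 / 2 * (‖p j x‖ ^ 2 + ‖p k x‖ ^ 2) + _
    nlinarith [sq_nonneg (‖p k x‖ - ‖p j x‖)]

variable (S)

/-- `|∇Ψ|²`. -/
def gradPsiSq (x : Space d) : ℝ := ∑ j, ∑ k, ‖gradient (S.Psi j k) x‖ ^ 2

theorem gradPsiSq_nonneg (x : Space d) : 0 ≤ S.gradPsiSq x :=
  Finset.sum_nonneg fun _ _ => Finset.sum_nonneg fun _ _ => sq_nonneg _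

theorem continuousOn_gradPsiSq : ContinuousOn S.gradPsiSq S.Ω :=
  continuousOn_finsetSum _ fun j _ => continuousOn_finsetSum _ fun k _ =>
    continuousOn_gradient_sq (S.contDiffOn_Psi j k)

theorem continuousOn_normB_sq_div_m : ContinuousOn (fun x => S.normB x ^ 2 / S.m x) S.Ω := by
  refine ContinuousOn.div ?_ S.contDiffOn_m.continuousOn fun x _ => (S.m_pos x).ne'
  simp only [normB_sq]
  exact continuousOn_finsetSum _ fun j _ => continuousOn_finsetSum _ fun k _ =>
    (S.contDiffOn_B j k).continuousOn.pow 2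

variable {S}

/-- The magnetic field is controlled by the magnetic gradient. -/
theorem integral_normB_le {f : Space d → ℂ} (hf : f ∈ S.compactC1) :
    ∫ x in S.Ω, S.normB x ^ 2 / S.m x * ‖f x‖ ^ 2
      ≤ 3 * d * (∫ x in S.Ω, S.gradSq f x) + ∫ x in S.Ω, S.gradPsiSq x * ‖f x‖ ^ 2 := by
  have hB (j k : Fin d) : IntegrableOn (fun x => S.B j k x * S.Psi j k x * ‖f x‖ ^ 2) S.Ω :=
    integrableOn_weight hf
      ((S.contDiffOn_B j k).continuousOn.mul (S.contDiffOn_Psi j k).continuousOn)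
  have hR (j k : Fin d) : IntegrableOn (fun x => 3 / 2 * (‖S.component f (some (some j)) x‖ ^ 2
        + ‖S.component f (some (some k)) x‖ ^ 2)
        + ‖gradient (S.Psi j k) x‖ ^ 2 * ‖f x‖ ^ 2) S.Ω :=
    (((integrableOn_component_sq hf _).add (integrableOn_component_sq hf _)).const_mul
      _).add (integrableOn_weight hf (continuousOn_gradient_sq (S.contDiffOn_Psi j k)))
  have e1 : ∫ x in S.Ω, S.normB x ^ 2 / S.m x * ‖f x‖ ^ 2
      = ∑ j, ∑ k, ∫ x in S.Ω, S.B j k x * S.Psi j k x * ‖f x‖ ^ 2 := by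
    simp_rw [← integral_finsetSum _ fun k _ => hB _ k]
    rw [← integral_finsetSum _ fun j _ => integrable_finsetSum _ fun k _ => hB j k]
    congr 1
    funext x
    rw [normB_sq, Finset.sum_div, Finset.sum_mul]
    refine Finset.sum_congr rfl fun j _ => ?_
    rw [Finset.sum_div, Finset.sum_mul]
    refine Finset.sum_congr rfl fun k _ => ?_
    rw [Psi]
    ring
  rw [e1]
  -- In the double sum each `|p_i|²` occurs `d` times as first and `d` times as second index, whence
  -- `3d = 2d · 3/2`.
  refine (Finset.sum_le_sum fun j _ => Finset.sum_le_sum fun k _ =>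
    integral_B_mul_Psi_le hf j k).trans (le_of_eq ?_)
  simp_rw [← integral_finsetSum _ fun k _ => hR _ k]
  rw [← integral_finsetSum _ fun j _ => integrable_finsetSum _ fun k _ => hR j k,
    ← integral_const_mul, ← integral_add ((integrableOn_gradSq hf).const_mul _)
      (integrableOn_weight hf S.continuousOn_gradPsiSq)]
  congr 1
  funext x
  simp only [Finset.sum_add_distrib, ← Finset.mul_sum, Finset.sum_const, Finset.card_univ,
    Fintype.card_fin, nsmul_eq_mul, gradSq, gradPsiSq, Finset.sum_mul]
  ring

/-! ### Consequences of the weight condition -/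

variable (S)

/-- The pointwise inequality of the standing condition, with given constants. -/
def WeightBound (γ₁ γ₂ : ℝ) : Prop :=
  ∀ x ∈ S.Ω, γ₁ * ‖S.V x‖ - γ₂ + 9 * (‖gradient S.Phi x‖ ^ 2 + S.gradPsiSq x)
    ≤ S.Phi x * (S.V x).im + 1 / (12 * (d : ℝ)) * (S.normB x ^ 2 / S.m x) + (S.V x).re

variable {S}

theorem WeightedCondition.exists_weightBound (h : S.WeightedCondition) :
    ∃ γ₁ γ₂ : ℝ, 0 < γ₁ ∧ S.WeightBound γ₁ γ₂ := by
  obtain ⟨γ₁, γ₂, h0, h⟩ := h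
  refine ⟨γ₁, γ₂, h0, fun x hx => ?_⟩
  have h1 := h x hx
  have h2 : ((S.V x).im ^ 2 + 1 / (12 * (d : ℝ)) * S.normB x ^ 2) / S.m x
      = S.Phi x * (S.V x).im + 1 / (12 * (d : ℝ)) * (S.normB x ^ 2 / S.m x) := by
    rw [Phi]
    ring
  rw [h2] at h1
  rw [gradPsiSq]
  linarith

/-- The magnetic lower bound, in the normalization of the standing condition. -/
theorem integral_normB_le' (hd : 1 ≤ d) {f : Space d → ℂ} (hf : f ∈ S.compactC1) :
    ∫ x in S.Ω, 1 / (12 * (d : ℝ)) * (S.normB x ^ 2 / S.m x) * ‖f x‖ ^ 2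
      ≤ 1 / 4 * (∫ x in S.Ω, S.gradSq f x) + ∫ x in S.Ω, S.gradPsiSq x * ‖f x‖ ^ 2 := by
  have hd' : (1 : ℝ) ≤ d := by exact_mod_cast hd
  have h0 : 0 ≤ ∫ x in S.Ω, S.gradPsiSq x * ‖f x‖ ^ 2 :=
    integral_nonneg fun x => mul_nonneg (S.gradPsiSq_nonneg x) (sq_nonneg _)
  have h1 := mul_le_mul_of_nonneg_left (integral_normB_le hf)
    (show 0 ≤ 1 / (12 * (d : ℝ)) by positivity)
  -- The small factor in front of `|∇Ψ|²` can be discarded: the hypothesis provides the coefficient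
  -- `9`.
  have h2 : 1 / (12 * (d : ℝ)) ≤ 1 := by
    rw [div_le_one (by positivity)]
    linarith
  have h3 := mul_le_mul_of_nonneg_right h2 h0
  have h4 : 1 / (12 * (d : ℝ)) * (3 * d * ∫ x in S.Ω, S.gradSq f x)
      = 1 / 4 * ∫ x in S.Ω, S.gradSq f x := by
    field_simp
    ring
  have h5 : ∫ x in S.Ω, 1 / (12 * (d : ℝ)) * (S.normB x ^ 2 / S.m x) * ‖f x‖ ^ 2
      = 1 / (12 * (d : ℝ)) * ∫ x in S.Ω, S.normB x ^ 2 / S.m x * ‖f x‖ ^ 2 := by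
    rw [← integral_const_mul]
    congr 1
    funext x
    ring
  linarith

theorem integral_energy {f : Space d → ℂ} (hf : f ∈ S.compactC1) :
    ∫ x in S.Ω, S.energy f x = (∫ x in S.Ω, ‖f x‖ ^ 2) + (∫ x in S.Ω, ‖S.V x‖ * ‖f x‖ ^ 2)
      + ∫ x in S.Ω, S.gradSq f x := by
  have h1 : IntegrableOn (fun x => ‖f x‖ ^ 2) S.Ω := integrableOn_component_sq hf none
  have h2 := integrableOn_weight hf S.continuousOn_V.norm
  have h3 := integrableOn_gradSq hf
  have h4 : IntegrableOn (fun x => ‖f x‖ ^ 2 + ‖S.V x‖ * ‖f x‖ ^ 2) S.Ω := h1.add h2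
  have e1 : (∫ x in S.Ω, ‖f x‖ ^ 2) + (∫ x in S.Ω, ‖S.V x‖ * ‖f x‖ ^ 2)
      = ∫ x in S.Ω, (‖f x‖ ^ 2 + ‖S.V x‖ * ‖f x‖ ^ 2) := (integral_add h1 h2).symm
  rw [e1]
  exact integral_add h4 h3

/-- The gradient of `Φ` is a bounded weight on the variational space. -/
theorem integral_gradient_Phi_le (hd : 1 ≤ d) {γ₁ γ₂ : ℝ} (hγ : 0 < γ₁)
    (h : S.WeightBound γ₁ γ₂) {f : Space d → ℂ} (hf : f ∈ S.compactC1) :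
    ∫ x in S.Ω, ‖gradient S.Phi x‖ ^ 2 * ‖f x‖ ^ 2
      ≤ (2 + |γ₂|) * ∫ x in S.Ω, S.energy f x := by
  have i0 : IntegrableOn (fun x => ‖f x‖ ^ 2) S.Ω := integrableOn_component_sq hf none
  have iV := integrableOn_weight hf S.continuousOn_V.norm
  have iΦ := integrableOn_weight hf (continuousOn_gradient_sq S.contDiffOn_Phi)
  have iΨ := integrableOn_weight hf S.continuousOn_gradPsiSq
  have iB : IntegrableOn (fun x => 1 / (12 * (d : ℝ)) * (S.normB x ^ 2 / S.m x) * ‖f x‖ ^ 2)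
      S.Ω := integrableOn_weight hf (continuousOn_const.mul S.continuousOn_normB_sq_div_m)
  -- The condition is read backwards, as an upper bound for the gradients. The `|∇Ψ|²` term is kept
  -- on the left with coefficient exactly `1`, so that it cancels the one produced by the magnetic
  -- lower bound.
  have h1 : ∫ x in S.Ω, (‖gradient S.Phi x‖ ^ 2 * ‖f x‖ ^ 2 + S.gradPsiSq x * ‖f x‖ ^ 2)
      ≤ ∫ x in S.Ω, (2 * (‖S.V x‖ * ‖f x‖ ^ 2) + |γ₂| * ‖f x‖ ^ 2
        + 1 / (12 * (d : ℝ)) * (S.normB x ^ 2 / S.m x) * ‖f x‖ ^ 2) := by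
    refine setIntegral_mono_on (iΦ.add iΨ) (((iV.const_mul 2).add (i0.const_mul _)).add iB)
      S.isOpen.measurableSet fun x hx => ?_
    have hx := h x hx
    have e1 : S.Phi x * (S.V x).im ≤ ‖S.V x‖ := by
      refine (le_abs_self _).trans ?_
      rw [abs_mul]
      exact (mul_le_of_le_one_left (abs_nonneg _) (S.abs_Phi_le x)).trans
        (Complex.abs_im_le_norm _)
    have e2 := Complex.re_le_norm (S.V x)
    have e3 := le_abs_self γ₂
    have e4 := S.gradPsiSq_nonneg x
    have e5 := mul_nonneg hγ.le (norm_nonneg (S.V x))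
    have e6 := sq_nonneg ‖gradient S.Phi x‖
    have e7 : ‖gradient S.Phi x‖ ^ 2 + S.gradPsiSq x ≤ 2 * ‖S.V x‖ + |γ₂|
        + 1 / (12 * (d : ℝ)) * (S.normB x ^ 2 / S.m x) := by linarith
    have e8 := mul_le_mul_of_nonneg_right e7 (sq_nonneg ‖f x‖)
    linarith
  have h2 := integral_normB_le' hd hf
  have r1 := integral_add iΦ iΨ
  have r2 := integral_add ((iV.const_mul 2).add (i0.const_mul |γ₂|)) iB
  have r3 := integral_add (iV.const_mul 2) (i0.const_mul |γ₂|)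
  simp only [Pi.add_apply] at r1 r2 r3
  rw [integral_const_mul, integral_const_mul] at r3
  have n1 : 0 ≤ ∫ x in S.Ω, ‖f x‖ ^ 2 := integral_nonneg fun x => sq_nonneg _
  have n2 : 0 ≤ ∫ x in S.Ω, ‖S.V x‖ * ‖f x‖ ^ 2 := integral_nonneg fun x => by positivity
  have n3 : 0 ≤ ∫ x in S.Ω, S.gradSq f x := integral_nonneg fun x => S.gradSq_nonneg f x
  rw [integral_energy hf]
  nlinarith [abs_nonneg γ₂, mul_nonneg (abs_nonneg γ₂) n2, mul_nonneg (abs_nonneg γ₂) n3]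

/-! ### Bounded multipliers and the operator of the form -/

variable (S)

/-- A measurable function that is bounded in `Ω`. -/
structure IsBoundedMultiplier (a : Space d → ℂ) : Prop where
  aestronglyMeasurable : AEStronglyMeasurable a (volume.restrict S.Ω)
  bound : ∃ C : ℝ, ∀ x ∈ S.Ω, ‖a x‖ ≤ C

variable {S}

namespace IsBoundedMultiplier

variable {a b : Space d → ℂ}

theorem ae_bound (ha : S.IsBoundedMultiplier a) (u : Space d → ℂ) :
    ∀ᵐ x ∂(volume.restrict S.Ω), ‖a x * u x‖ ≤ ha.bound.choose * ‖u x‖ := by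
  refine (ae_restrict_iff' S.isOpen.measurableSet).2 (Filter.Eventually.of_forall fun x hx => ?_)
  rw [norm_mul]
  exact mul_le_mul_of_nonneg_right (ha.bound.choose_spec x hx) (norm_nonneg _)

theorem memLp (ha : S.IsBoundedMultiplier a) {u : Space d → ℂ}
    (hu : MemLp u 2 (volume.restrict S.Ω)) :
    MemLp (fun x => a x * u x) 2 (volume.restrict S.Ω) :=
  hu.of_le_mul (ha.aestronglyMeasurable.mul hu.1) (ha.ae_bound u)

/-- The multiplication operator in `L²(Ω)` by a bounded function. -/
def mulOp (ha : S.IsBoundedMultiplier a) : S.H →L[ℂ] S.H :=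
  LinearMap.mkContinuous
    { toFun := fun u => (ha.memLp (Lp.memLp u)).toLp _
      map_add' := fun u v => by
        rw [← MemLp.toLp_add]
        refine MemLp.toLp_congr _ _ ?_
        filter_upwards [Lp.coeFn_add u v] with x hx
        rw [hx, Pi.add_apply, mul_add, Pi.add_apply]
      map_smul' := fun c u => by
        rw [RingHom.id_apply, ← MemLp.toLp_const_smul]
        refine MemLp.toLp_congr _ _ ?_
        filter_upwards [Lp.coeFn_smul c u] with x hx
        rw [hx, Pi.smul_apply, Pi.smul_apply, smul_eq_mul, smul_eq_mul]
        ring }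
    ha.bound.choose fun u => by
      refine Lp.norm_le_mul_norm_of_ae_le_mul ?_
      filter_upwards [(ha.memLp (Lp.memLp u)).coeFn_toLp, ha.ae_bound u] with x h1 h2
      exact (le_of_eq (congrArg norm h1)).trans h2

theorem coeFn_mulOp (ha : S.IsBoundedMultiplier a) (u : S.H) :
    ha.mulOp u =ᵐ[volume.restrict S.Ω] fun x => a x * u x :=
  (ha.memLp (Lp.memLp u)).coeFn_toLp

theorem inner_mulOp (ha : S.IsBoundedMultiplier a) (u v : S.H) :
    inner ℂ v (ha.mulOp u) = ∫ x in S.Ω, a x * u x * conj (v x) := by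
  rw [inner_eq_integral]
  refine integral_congr_ae ?_
  filter_upwards [ha.coeFn_mulOp u] with x hx
  rw [hx]

theorem inner_toLp_mulOp (ha : S.IsBoundedMultiplier a) {f h : Space d → ℂ}
    (hf : MemLp f 2 (volume.restrict S.Ω)) (hh : MemLp h 2 (volume.restrict S.Ω)) :
    inner ℂ (hh.toLp h : S.H) (ha.mulOp (hf.toLp f)) = ∫ x in S.Ω, a x * f x * conj (h x) := by
  rw [inner_mulOp]
  refine integral_congr_ae ?_
  filter_upwards [hf.coeFn_toLp, hh.coeFn_toLp] with x h1 h2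
  rw [h1, h2]

end IsBoundedMultiplier

variable (S)

/-- The phase of `V` is bounded, with value `0` at the zeros of `V` by the convention for division.
It may be discontinuous there, so bounded multipliers are only required to be measurable. -/
theorem isBoundedMultiplier_sign_V :
    S.IsBoundedMultiplier fun x => S.V x / ((‖S.V x‖ : ℝ) : ℂ) := by
  refine ⟨(S.aestronglyMeasurable_V.aemeasurable.div
    S.aestronglyMeasurable_V.norm.aemeasurable.complex_ofReal).aestronglyMeasurable,
    1, fun x _ => ?_⟩
  rw [norm_div, Complex.norm_real, norm_norm]
  exact div_self_le_one _

/-- Splitting `|V|` evenly between the two arguments leaves only the phase of `V`; thus the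
unbounded potential term becomes a bounded form of the weighted components. -/
theorem sign_V_mul (x : Space d) (a b : ℂ) :
    S.V x / ((‖S.V x‖ : ℝ) : ℂ) * (((Real.sqrt ‖S.V x‖ : ℝ) : ℂ) * a)
      * conj (((Real.sqrt ‖S.V x‖ : ℝ) : ℂ) * b) = S.V x * a * conj b := by
  have h1 : ((Real.sqrt ‖S.V x‖ : ℝ) : ℂ) * ((Real.sqrt ‖S.V x‖ : ℝ) : ℂ)
      = ((‖S.V x‖ : ℝ) : ℂ) := by
    rw [← Complex.ofReal_mul, Real.mul_self_sqrt (norm_nonneg _)]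
  have h2 : S.V x / ((‖S.V x‖ : ℝ) : ℂ) * ((‖S.V x‖ : ℝ) : ℂ) = S.V x := by
    by_cases h : S.V x = 0
    · simp [h]
    · exact div_mul_cancel₀ _ (by simpa using h)
  rw [map_mul, Complex.conj_ofReal]
  linear_combination (S.V x / ((‖S.V x‖ : ℝ) : ℂ) * a * conj b) * h1 + a * conj b * h2

/-- The components of the operator in `L²(Ω)^{d+2}` that represents the shifted form. -/
def formComponent (c : ℝ) : Option (Option (Fin d)) → S.H →L[ℂ] S.H
  | none => (c : ℂ) • ContinuousLinearMap.id ℂ S.H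
  | some none => S.isBoundedMultiplier_sign_V.mulOp
  | some (some _) => ContinuousLinearMap.id ℂ S.H

/-- The operator in `L²(Ω)^{d+2}` that represents the form `Q + c`. -/
def formOp (c : ℝ) : S.GraphSpace →L[ℂ] S.GraphSpace :=
  ((PiLp.continuousLinearEquiv 2 ℂ fun _ : Option (Option (Fin d)) => S.H).symm :
      (Option (Option (Fin d)) → S.H) →L[ℂ] S.GraphSpace) ∘L
    ContinuousLinearMap.pi fun i => S.formComponent c i ∘L PiLp.proj 2 _ i

theorem inner_formOp (c : ℝ) (x y : S.GraphSpace) :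
    inner ℂ y (S.formOp c x) = c * inner ℂ (y none) (x none)
      + (inner ℂ (y (some none)) (S.isBoundedMultiplier_sign_V.mulOp (x (some none)))
        + ∑ j, inner ℂ (y (some (some j))) (x (some (some j)))) := by
  rw [PiLp.inner_apply, Fintype.sum_option, Fintype.sum_option, ← inner_smul_right]
  rfl

/-- The closure of `C¹_0(Ω)` for the variational norm. -/
def formSpace : Submodule ℂ S.GraphSpace := (LinearMap.range S.graphMap).topologicalClosure

instance : CompleteSpace S.formSpace :=
  (Submodule.isClosed_topologicalClosure _).completeSpace_coe

/-- The embedding of `C¹_0(Ω)` into its completion. -/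
def toFormSpace : S.compactC1 →ₗ[ℂ] S.formSpace :=
  S.graphMap.codRestrict _ fun f =>
    Submodule.le_topologicalClosure _ (LinearMap.mem_range_self _ f)

theorem denseRange_toFormSpace : DenseRange S.toFormSpace := by
  intro x
  rw [closure_subtype]
  have h : (Subtype.val '' Set.range S.toFormSpace : Set S.GraphSpace)
      = (LinearMap.range S.graphMap : Set S.GraphSpace) := by
    rw [← Set.range_comp]
    rfl
  rw [h]
  exact x.2

/-- Test functions are dense in the completion. -/
theorem formSpace_subset_closure :
    (S.formSpace : Set S.GraphSpace) ⊆ closure (S.graphMap '' {φ | S.IsTestFunction φ}) := by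
  refine closure_minimal ?_ isClosed_closure
  rintro _ ⟨f, rfl⟩
  exact graphMap_mem_closure f

/-! ### Multiplication by functions of `Φ` on the completion -/

/-- The functions whose gradient is controlled by the gradient of `Φ`. -/
structure IsPhiMultiplier (g : Space d → ℂ) : Prop where
  contDiffOn : ContDiffOn ℝ 1 g S.Ω
  bound : ∀ x ∈ S.Ω, ‖g x‖ ≤ 2
  fderiv_bound : ∀ x ∈ S.Ω, ∀ j, ‖fderiv ℝ g x (basisVec j)‖ ≤ |fderiv ℝ S.Phi x (basisVec j)|

variable {S}

/-- The multiplication by a `C¹` function, as an operator in `C¹_0(Ω)`. -/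
def mulC1 {g : Space d → ℂ} (hg : ContDiffOn ℝ 1 g S.Ω) : S.compactC1 →ₗ[ℂ] S.compactC1 where
  toFun f := ⟨fun x => g x * (f : Space d → ℂ) x, mul_mem_compactC1 hg f.2⟩
  map_add' f h := by
    ext x
    exact mul_add _ _ _
  map_smul' c f := by
    ext x
    exact mul_left_comm _ _ _

theorem mulC1_apply {g : Space d → ℂ} (hg : ContDiffOn ℝ 1 g S.Ω) (f : S.compactC1)
    (x : Space d) : (mulC1 hg f : Space d → ℂ) x = g x * (f : Space d → ℂ) x := rfl

theorem integrableOn_energy {f : Space d → ℂ} (hf : f ∈ S.compactC1) :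
    IntegrableOn (S.energy f) S.Ω :=
  ((integrableOn_component_sq hf none).add (integrableOn_weight hf S.continuousOn_V.norm)).add
    (integrableOn_gradSq hf)

namespace IsPhiMultiplier

variable {g : Space d → ℂ}

/-- By the product rule, only `|∇g||f| ≤ |∇Φ||f|` is not obviously controlled, and its square is
integrated by `integral_gradient_Phi_le`. -/
theorem exists_norm_graphMap_le (hg : S.IsPhiMultiplier g) (hd : 1 ≤ d) {γ₁ γ₂ : ℝ} (hγ : 0 < γ₁)
    (h : S.WeightBound γ₁ γ₂) :
    ∃ C : ℝ, ∀ f : S.compactC1, ‖S.graphMap (mulC1 hg.contDiffOn f)‖ ≤ C * ‖S.graphMap f‖ := by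
  -- From `(2a + b)² ≤ 8a² + 2b²`, where `2` bounds `|g|` and `2 + |γ₂|` is the constant of
  -- `integral_gradient_Phi_le`.
  set D := 8 + 2 * (2 + |γ₂|)
  have hD : 0 ≤ D := by positivity
  refine ⟨Real.sqrt D, fun f => ?_⟩
  refine le_of_sq_le_sq ?_ (by positivity)
  rw [mul_pow, Real.sq_sqrt hD, norm_graphMap_sq, norm_graphMap_sq]
  have iΦ := integrableOn_weight f.2 (continuousOn_gradient_sq S.contDiffOn_Phi)
  have iE := integrableOn_energy f.2
  have h1 : ∫ x in S.Ω, S.energy (mulC1 hg.contDiffOn f) x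
      ≤ ∫ x in S.Ω, (8 * S.energy f x
        + 2 * (‖gradient S.Phi x‖ ^ 2 * ‖(f : Space d → ℂ) x‖ ^ 2)) := by
    refine setIntegral_mono_on (integrableOn_energy (mulC1 hg.contDiffOn f).2)
      ((iE.const_mul 8).add (iΦ.const_mul 2)) S.isOpen.measurableSet fun x hx => ?_
    have hb := hg.bound x hx
    have hp : S.gradSq (mulC1 hg.contDiffOn f) x ≤ 8 * S.gradSq f x
        + 2 * (‖gradient S.Phi x‖ ^ 2 * ‖(f : Space d → ℂ) x‖ ^ 2) := by
      rw [norm_gradient_sq, gradSq, gradSq, Finset.sum_mul, Finset.mul_sum, Finset.mul_sum,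
        ← Finset.sum_add_distrib]
      refine Finset.sum_le_sum fun j _ => ?_
      have h2 : S.component (mulC1 hg.contDiffOn f) (some (some j)) x
          = g x * S.component f (some (some j)) x
            - Complex.I * fderiv ℝ g x (basisVec j) * (f : Space d → ℂ) x :=
        component_mul hg.contDiffOn f.2 j hx
      have h3 : ‖S.component (mulC1 hg.contDiffOn f) (some (some j)) x‖
          ≤ 2 * ‖S.component f (some (some j)) x‖
            + |fderiv ℝ S.Phi x (basisVec j)| * ‖(f : Space d → ℂ) x‖ := by
        rw [h2]
        refine (norm_sub_le _ _).trans ?_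
        rw [norm_mul, norm_mul, norm_mul, Complex.norm_I, one_mul]
        exact add_le_add (mul_le_mul_of_nonneg_right hb (norm_nonneg _))
          (mul_le_mul_of_nonneg_right (hg.fderiv_bound x hx j) (norm_nonneg _))
      refine (pow_le_pow_left₀ (norm_nonneg _) h3 2).trans ?_
      rw [← sq_abs (fderiv ℝ S.Phi x (basisVec j))]
      nlinarith [sq_nonneg (2 * ‖S.component f (some (some j)) x‖
        - |fderiv ℝ S.Phi x (basisVec j)| * ‖(f : Space d → ℂ) x‖)]
    have h4 : ‖(mulC1 hg.contDiffOn f : Space d → ℂ) x‖ ^ 2 ≤ 4 * ‖(f : Space d → ℂ) x‖ ^ 2 := by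
      rw [mulC1_apply, norm_mul, mul_pow]
      refine mul_le_mul_of_nonneg_right ?_ (sq_nonneg _)
      nlinarith [norm_nonneg (g x)]
    have h5 := mul_le_mul_of_nonneg_left h4 (norm_nonneg (S.V x))
    have h6 := mul_nonneg (norm_nonneg (S.V x)) (sq_nonneg ‖(f : Space d → ℂ) x‖)
    have h7 := sq_nonneg ‖(f : Space d → ℂ) x‖
    simp only [energy]
    linarith
  have h2 := integral_gradient_Phi_le hd hγ h f.2
  have h3 := integral_add (iE.const_mul 8) (iΦ.const_mul 2)
  rw [integral_const_mul, integral_const_mul] at h3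
  refine h1.trans ?_
  rw [h3]
  simp only [D]
  linarith

variable (S) in
/-- The extension to the completion of the multiplication by `g`. -/
def _root_.Electromagnetic.Potentials.formMul (hg : S.IsPhiMultiplier g) :
    S.formSpace →L[ℂ] S.formSpace :=
  (S.toFormSpace ∘ₗ mulC1 hg.contDiffOn).extendOfNorm S.toFormSpace

/-- The definition of `formMul` carries no norm bound; it is here, through the weight condition,
that the extension is shown to agree with multiplication on `C¹_0(Ω)`. -/
theorem formMul_toFormSpace (hg : S.IsPhiMultiplier g) (hd : 1 ≤ d) {γ₁ γ₂ : ℝ} (hγ : 0 < γ₁)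
    (h : S.WeightBound γ₁ γ₂) (f : S.compactC1) :
    S.formMul hg (S.toFormSpace f) = S.toFormSpace (mulC1 hg.contDiffOn f) :=
  LinearMap.extendOfNorm_eq S.denseRange_toFormSpace
    (hg.exists_norm_graphMap_le hd hγ h) f

end IsPhiMultiplier

variable (S)

theorem isPhiMultiplier_one_add : S.IsPhiMultiplier fun x => 1 + Complex.I * (S.Phi x : ℂ) := by
  refine ⟨contDiffOn_const.add (contDiffOn_const.mul (contDiffOn_ofReal S.contDiffOn_Phi)),
    fun x _ => ?_, fun x hx j => ?_⟩
  · refine (norm_add_le _ _).trans ?_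
    rw [norm_one, norm_mul, Complex.norm_I, one_mul, Complex.norm_real, Real.norm_eq_abs]
    linarith [S.abs_Phi_le x]
  · have hΦ := differentiableAt_of_mem S.contDiffOn_Phi hx
    have h1 := (differentiableAt_of_mem (contDiffOn_ofReal S.contDiffOn_Phi) hx).hasFDerivAt
    have h2 := (h1.const_mul Complex.I).const_add 1
    rw [h2.fderiv, smul_apply, fderiv_ofReal_comp hΦ, smul_eq_mul, norm_mul, Complex.norm_I,
      one_mul, Complex.norm_real, Real.norm_eq_abs]

theorem one_le_norm_one_add (x : Space d) : 1 ≤ ‖1 + Complex.I * (S.Phi x : ℂ)‖ := by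
  have := Complex.abs_re_le_norm (1 + Complex.I * (S.Phi x : ℂ))
  simpa using this

/-- Since `1 + iΦ` has real part `1`, its inverse has modulus at most `1`, and the derivative
`-g⁻¹(∂g)g⁻¹` is no larger than `∂g`. -/
theorem isPhiMultiplier_inv :
    S.IsPhiMultiplier fun x => (1 + Complex.I * (S.Phi x : ℂ))⁻¹ := by
  have h0 (x : Space d) : 1 + Complex.I * (S.Phi x : ℂ) ≠ 0 :=
    norm_pos_iff.1 (one_pos.trans_le (S.one_le_norm_one_add x))
  have hg := S.isPhiMultiplier_one_add
  refine ⟨hg.contDiffOn.inv fun x _ => h0 x, fun x _ => ?_, fun x hx j => ?_⟩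
  · rw [norm_inv]
    exact (inv_le_one_of_one_le₀ (S.one_le_norm_one_add x)).trans one_le_two
  · have h1 := (differentiableAt_of_mem hg.contDiffOn hx).hasFDerivAt
    have h2 : HasFDerivAt (fun x => (1 + Complex.I * (S.Phi x : ℂ))⁻¹) _ x :=
      (hasFDerivAt_inv' (𝕜 := ℝ) (h0 x)).comp x h1
    refine le_trans ?_ (hg.fderiv_bound x hx j)
    rw [h2.fderiv]
    have h3 : ‖(1 + Complex.I * (S.Phi x : ℂ))⁻¹‖ ≤ 1 := by
      rw [norm_inv]
      exact inv_le_one_of_one_le₀ (S.one_le_norm_one_add x)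
    simp only [ContinuousLinearMap.comp_apply, neg_apply,
      ContinuousLinearMap.mulLeftRight_apply, norm_neg, norm_mul]
    have h4 := norm_nonneg (fderiv ℝ (fun x => 1 + Complex.I * (S.Phi x : ℂ)) x (basisVec j))
    have h5 := norm_nonneg (1 + Complex.I * (S.Phi x : ℂ))⁻¹
    calc _ ≤ 1 * ‖fderiv ℝ (fun x => 1 + Complex.I * (S.Phi x : ℂ)) x (basisVec j)‖ * 1 := by
          gcongr
      _ = _ := by ring

end Potentials
end Electromagnetic

/-! ### Invertibility of operators in a Hilbert space -/

/-- The Lax–Milgram theorem for coercive operators in a complex Hilbert space. -/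
theorem ContinuousLinearMap.bijective_of_coercive {K : Type*} [NormedAddCommGroup K]
    [InnerProductSpace ℂ K] [CompleteSpace K] (T : K →L[ℂ] K) {α : ℝ} (hα : 0 < α)
    (h : ∀ x, α * ‖x‖ ^ 2 ≤ (inner ℂ x (T x)).re) : Function.Bijective T := by
  have hb (x : K) : α * ‖x‖ ≤ ‖T x‖ := by
    rcases (norm_nonneg x).eq_or_lt with h0 | h0
    · rw [← h0, mul_zero]
      exact norm_nonneg _
    · have h1 := (h x).trans ((Complex.re_le_norm _).trans (norm_inner_le_norm x (T x)))
      nlinarith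
  have hanti : AntilipschitzWith (Real.toNNReal α⁻¹) T := by
    refine AddMonoidHomClass.antilipschitz_of_bound T fun x => ?_
    rw [Real.coe_toNNReal _ (inv_nonneg.2 hα.le), inv_mul_eq_div, le_div_iff₀ hα, mul_comm]
    exact hb x
  refine ⟨hanti.injective, ?_⟩
  have hclosed : IsClosed (LinearMap.range T.toLinearMap : Set K) :=
    hanti.isClosed_range T.uniformContinuous
  have : CompleteSpace (LinearMap.range T.toLinearMap) := hclosed.completeSpace_coe
  have hbot : (LinearMap.range T.toLinearMap)ᗮ = ⊥ := by
    rw [Submodule.eq_bot_iff]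
    intro x hx
    have h1 : inner ℂ x (T x) = 0 :=
      (Submodule.mem_orthogonal' _ x).1 hx _ (LinearMap.mem_range_self _ x)
    have h2 := h x
    rw [h1, Complex.zero_re] at h2
    have h3 : ‖x‖ ^ 2 ≤ 0 := by nlinarith
    exact norm_eq_zero.1 (pow_eq_zero_iff two_ne_zero |>.1 (le_antisymm h3 (sq_nonneg _)))
  exact LinearMap.range_eq_top.1 ((Submodule.orthogonal_eq_bot_iff).1 hbot)

/-- The adjoint of the bounded inverse is a two-sided inverse of the adjoint. This serves both for
the multiplication by `1 + iΦ` and, in the density of the domain, for the operator of the form. -/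
theorem ContinuousLinearMap.bijective_adjoint {K : Type*} [NormedAddCommGroup K]
    [InnerProductSpace ℂ K] [CompleteSpace K] (T : K →L[ℂ] K) (h : Function.Bijective T) :
    Function.Bijective (ContinuousLinearMap.adjoint T) := by
  let e := ContinuousLinearEquiv.ofBijective T (LinearMap.ker_eq_bot.2 h.1)
    (LinearMap.range_eq_top.2 h.2)
  have h1 : (e.symm : K →L[ℂ] K) ∘L T = ContinuousLinearMap.id ℂ K := by
    ext x
    exact e.symm_apply_apply x
  have h2 : T ∘L (e.symm : K →L[ℂ] K) = ContinuousLinearMap.id ℂ K := by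
    ext x
    exact e.apply_symm_apply x
  have h3 := congrArg ContinuousLinearMap.adjoint h1
  have h4 := congrArg ContinuousLinearMap.adjoint h2
  rw [ContinuousLinearMap.adjoint_comp, ContinuousLinearMap.adjoint_id] at h3 h4
  exact Function.bijective_iff_has_inverse.2 ⟨_, fun x => congrArg (· x) h4,
    fun x => congrArg (· x) h3⟩

/-! ### Coercivity of the twisted form and invertibility -/

namespace Electromagnetic
namespace Potentials

variable {d : ℕ} {S : Potentials d}

/-- The coercivity of the shifted form twisted by `1 + iΦ`, on `C¹_0(Ω)`. -/
theorem coercive_graphMap (hd : 1 ≤ d) {γ₁ γ₂ : ℝ} (h : S.WeightBound γ₁ γ₂) (f : S.compactC1) :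
    min (1 / 2) γ₁ * ‖S.graphMap f‖ ^ 2
      ≤ (inner ℂ (S.graphMap (mulC1 S.isPhiMultiplier_one_add.contDiffOn f))
        (S.formOp (|γ₂| + 1) (S.graphMap f))).re := by
  set g : Space d → ℂ := fun x => 1 + Complex.I * (S.Phi x : ℂ) with hg
  have hgC : ContDiffOn ℝ 1 g S.Ω := S.isPhiMultiplier_one_add.contDiffOn
  set F : Space d → ℂ := (f : Space d → ℂ)
  have hF : F ∈ S.compactC1 := f.2
  have hG : (fun x => g x * F x) ∈ S.compactC1 := mul_mem_compactC1 hgC hF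
  set G : Space d → ℂ := fun x => g x * F x
  have hGc : ContinuousOn (fun x => conj (G x)) S.Ω :=
    (Complex.continuous_conj.comp hG.1.continuous).continuousOn
  have i0 : IntegrableOn (fun x => F x * conj (G x)) S.Ω :=
    integrableOn_of_eq_zero hF (hF.1.continuous.continuousOn.mul hGc)
      fun x hx => by simp [image_eq_zero_of_notMem_tsupport hx]
  have iV : IntegrableOn (fun x => S.V x * F x * conj (G x)) S.Ω :=
    integrableOn_of_eq_zero hF ((S.continuousOn_V.mul hF.1.continuous.continuousOn).mul hGc)
      fun x hx => by simp [image_eq_zero_of_notMem_tsupport hx]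
  have iP (j : Fin d) : IntegrableOn (fun x => S.component F (some (some j)) x
      * conj (S.component G (some (some j)) x)) S.Ω :=
    integrableOn_of_eq_zero hF ((continuousOn_component hF _).mul
      (Complex.continuous_conj.comp_continuousOn (continuousOn_component hG _)))
      fun x hx => by simp [component_eq_zero hx]
  have iS : IntegrableOn (fun x => ∑ j, S.component F (some (some j)) x
      * conj (S.component G (some (some j)) x)) S.Ω := integrable_finsetSum _ fun j _ => iP j
  have iVS : IntegrableOn (fun x => S.V x * F x * conj (G x)
      + ∑ j, S.component F (some (some j)) x * conj (S.component G (some (some j)) x)) S.Ω :=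
    iV.add iS
  have hq : inner ℂ (S.graphMap (mulC1 hgC f)) (S.formOp (|γ₂| + 1) (S.graphMap f))
      = ∫ x in S.Ω, (((|γ₂| + 1 : ℝ) : ℂ) * (F x * conj (G x)) + (S.V x * F x * conj (G x)
        + ∑ j, S.component F (some (some j)) x * conj (S.component G (some (some j)) x))) := by
    rw [integral_add (i0.const_mul _) iVS, integral_add iV iS,
      integral_finsetSum _ fun j _ => iP j, integral_const_mul, inner_formOp]
    simp only [graphMap_apply, inner_toLp, IsBoundedMultiplier.inner_toLp_mulOp]
    simp only [component_some_none, sign_V_mul]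
    rfl
  have iT := ((i0.const_mul ((|γ₂| + 1 : ℝ) : ℂ)).add iVS)
  have hre := Complex.reCLM.integral_comp_comm iT
  simp only [Pi.add_apply] at hre
  rw [hq]
  refine le_of_le_of_eq ?_ hre
  have j0 : IntegrableOn (fun x => ‖F x‖ ^ 2) S.Ω := integrableOn_component_sq hF none
  have jV := integrableOn_weight hF S.continuousOn_V.norm
  have jΨ := integrableOn_weight hF S.continuousOn_gradPsiSq
  have jP := integrableOn_gradSq hF
  have jB : IntegrableOn (fun x => 1 / (12 * (d : ℝ)) * (S.normB x ^ 2 / S.m x) * ‖F x‖ ^ 2)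
      S.Ω := integrableOn_weight hF (continuousOn_const.mul S.continuousOn_normB_sq_div_m)
  have jT := Complex.reCLM.integrable_comp iT
  -- The weight condition is pointwise but the magnetic bound holds only after integration. The
  -- field term is therefore added to the right-hand side here and removed later in integrated form.
  have hmono : ∫ x in S.Ω, (‖F x‖ ^ 2 + (γ₁ * (‖S.V x‖ * ‖F x‖ ^ 2)
      + (S.gradPsiSq x * ‖F x‖ ^ 2 + 3 / 4 * S.gradSq F x)))
      ≤ ∫ x in S.Ω, (Complex.reCLM (((|γ₂| + 1 : ℝ) : ℂ) * (F x * conj (G x))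
        + (S.V x * F x * conj (G x)
        + ∑ j, S.component F (some (some j)) x * conj (S.component G (some (some j)) x)))
        + 1 / (12 * (d : ℝ)) * (S.normB x ^ 2 / S.m x) * ‖F x‖ ^ 2) := by
    refine setIntegral_mono_on (j0.add ((jV.const_mul _).add (jΨ.add (jP.const_mul _))))
      (jT.add jB) S.isOpen.measurableSet fun x hx => ?_
    have hΦ := differentiableAt_of_mem S.contDiffOn_Phi hx
    have e0 : F x * conj (G x) = ((‖F x‖ ^ 2 : ℝ) : ℂ) * (1 - Complex.I * (S.Phi x : ℂ)) := by
      rw [← Complex.normSq_eq_norm_sq, ← Complex.mul_conj]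
      simp only [G, g, map_mul, map_add, map_one, Complex.conj_I, Complex.conj_ofReal]
      ring
    have e1 : (S.V x * F x * conj (G x)).re
        = ((S.V x).re + S.Phi x * (S.V x).im) * ‖F x‖ ^ 2 := by
      rw [mul_assoc, e0]
      simp [-Complex.ofReal_pow, Complex.mul_re, Complex.mul_im]
      ring
    have e2 : (((|γ₂| + 1 : ℝ) : ℂ) * (F x * conj (G x))).re = (|γ₂| + 1) * ‖F x‖ ^ 2 := by
      rw [e0]
      simp [-Complex.ofReal_pow, Complex.mul_re, Complex.mul_im]
    have e3 : 3 / 4 * S.gradSq F x - ‖gradient S.Phi x‖ ^ 2 * ‖F x‖ ^ 2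
        ≤ (∑ j, S.component F (some (some j)) x
          * conj (S.component G (some (some j)) x)).re := by
      rw [Complex.re_sum, norm_gradient_sq, gradSq, Finset.mul_sum, Finset.sum_mul,
        ← Finset.sum_sub_distrib]
      refine Finset.sum_le_sum fun j _ => ?_
      set p := S.component F (some (some j)) x with hp
      set a := fderiv ℝ S.Phi x (basisVec j)
      have h1 : fderiv ℝ g x (basisVec j) = Complex.I * (a : ℂ) := by
        have h1 := (differentiableAt_of_mem (contDiffOn_ofReal S.contDiffOn_Phi) hx).hasFDerivAt
        rw [((h1.const_mul Complex.I).const_add 1).fderiv, smul_apply,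
          fderiv_ofReal_comp hΦ, smul_eq_mul]
      have h2 : S.component G (some (some j)) x = g x * p + (a : ℂ) * F x := by
        rw [component_mul hgC hF j hx, h1, ← hp]
        linear_combination (-(a : ℂ) * F x) * Complex.I_mul_I
      have h3 : p * conj (g x * p + (a : ℂ) * F x)
          = ((‖p‖ ^ 2 : ℝ) : ℂ) * (1 - Complex.I * (S.Phi x : ℂ)) + (a : ℂ) * (p * conj (F x)) := by
        rw [← Complex.normSq_eq_norm_sq, ← Complex.mul_conj]
        simp only [g, map_mul, map_add, map_one, Complex.conj_I, Complex.conj_ofReal]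
        ring
      have h4 : |a * (p * conj (F x)).re| ≤ |a| * (‖p‖ * ‖F x‖) := by
        rw [abs_mul]
        refine mul_le_mul_of_nonneg_left ((Complex.abs_re_le_norm _).trans (le_of_eq ?_))
          (abs_nonneg _)
        rw [norm_mul, RCLike.norm_conj]
      rw [h2, h3, Complex.add_re, Complex.re_ofReal_mul, Complex.re_ofReal_mul]
      have h5 : (1 - Complex.I * (S.Phi x : ℂ)).re = 1 := by simp
      rw [h5, ← sq_abs a]
      have h6 := neg_abs_le (a * (p * conj (F x)).re)
      -- The cross term is absorbed by `|a||p||F| ≤ ¼|p|² + a²|F|²`, which leaves `¾|p|²`.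
      nlinarith [sq_nonneg (‖p‖ - 2 * (|a| * ‖F x‖))]
    simp only [Complex.reCLM_apply, Complex.add_re]
    rw [e2, e1]
    have e4 := mul_le_mul_of_nonneg_right (h x hx) (sq_nonneg ‖F x‖)
    have e5 := mul_nonneg (S.gradPsiSq_nonneg x) (sq_nonneg ‖F x‖)
    have e6 := mul_nonneg (sq_nonneg ‖gradient S.Phi x‖) (sq_nonneg ‖F x‖)
    have e7 := mul_le_mul_of_nonneg_right (le_abs_self γ₂) (sq_nonneg ‖F x‖)
    linarith
  have r1 := integral_add j0 ((jV.const_mul γ₁).add (jΨ.add (jP.const_mul (3 / 4))))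
  have r2 := integral_add (jV.const_mul γ₁) (jΨ.add (jP.const_mul (3 / 4)))
  have r3 := integral_add jΨ (jP.const_mul (3 / 4))
  have r4 := integral_add jT jB
  simp only [Pi.add_apply, integral_const_mul] at r1 r2 r3 r4
  -- Removing the field term costs `¼` of the kinetic energy, leaving `¾ - ¼ = ½`, and the whole
  -- `|∇Ψ|²` term kept on the left of `hmono`.
  have hB := integral_normB_le' hd hF
  rw [r1, r2, r3, r4] at hmono
  rw [norm_graphMap_sq, integral_energy hF]
  have n1 : 0 ≤ ∫ x in S.Ω, ‖F x‖ ^ 2 := integral_nonneg fun x => sq_nonneg _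
  have n2 : 0 ≤ ∫ x in S.Ω, ‖S.V x‖ * ‖F x‖ ^ 2 := integral_nonneg fun x => by positivity
  have n3 : 0 ≤ ∫ x in S.Ω, S.gradSq F x := integral_nonneg fun x => S.gradSq_nonneg F x
  have m1 := mul_le_mul_of_nonneg_right (min_le_left (1 / 2) γ₁) n1
  have m2 := mul_le_mul_of_nonneg_right (min_le_right (1 / 2) γ₁) n2
  have m3 := mul_le_mul_of_nonneg_right (min_le_left (1 / 2) γ₁) n3
  linarith

variable (S)

/-- The operator in the completion that represents the form `Q + c`. -/
def coerciveOp (c : ℝ) : S.formSpace →L[ℂ] S.formSpace :=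
  S.formSpace.orthogonalProjectionOnto ∘L S.formOp c ∘L S.formSpace.subtypeL

variable {S}

theorem inner_coerciveOp (c : ℝ) (x y : S.formSpace) :
    inner ℂ y (S.coerciveOp c x) = inner ℂ (y : S.GraphSpace) (S.formOp c x) := by
  rw [coerciveOp, ContinuousLinearMap.comp_apply]
  exact Submodule.inner_orthogonalProjectionOnto_eq_of_mem_left _ _

theorem coercive_formSpace (hd : 1 ≤ d) {γ₁ γ₂ : ℝ} (hγ : 0 < γ₁) (h : S.WeightBound γ₁ γ₂)
    (x : S.formSpace) : min (1 / 2) γ₁ * ‖x‖ ^ 2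
      ≤ (inner ℂ (S.formMul S.isPhiMultiplier_one_add x)
        (S.coerciveOp (|γ₂| + 1) x)).re := by
  refine S.denseRange_toFormSpace.induction_on x (isClosed_le ?_ ?_) fun f => ?_
  · fun_prop
  · exact Complex.continuous_re.comp ((ContinuousLinearMap.continuous _).inner
      (ContinuousLinearMap.continuous _))
  · rw [inner_coerciveOp, IsPhiMultiplier.formMul_toFormSpace _ hd hγ h]
    exact coercive_graphMap hd h f

/-- Multiplications by `1 + iΦ` and by its inverse are both bounded, and they undo each other on the
dense subspace `C¹_0(Ω)`, hence everywhere. -/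
theorem bijective_formMul (hd : 1 ≤ d) {γ₁ γ₂ : ℝ} (hγ : 0 < γ₁) (h : S.WeightBound γ₁ γ₂) :
    Function.Bijective (S.formMul S.isPhiMultiplier_one_add) := by
  have key {g g' : Space d → ℂ} (hg : S.IsPhiMultiplier g) (hg' : S.IsPhiMultiplier g')
      (hgg : ∀ x, g x * g' x = 1) (x : S.formSpace) : S.formMul hg (S.formMul hg' x) = x := by
    refine S.denseRange_toFormSpace.induction_on x (isClosed_eq ?_ ?_) fun f => ?_
    · fun_prop
    · fun_prop
    · rw [hg'.formMul_toFormSpace hd hγ h, hg.formMul_toFormSpace hd hγ h]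
      congr 1
      ext x
      rw [mulC1_apply, mulC1_apply, ← mul_assoc, hgg, one_mul]
  have h0 (x : Space d) : 1 + Complex.I * (S.Phi x : ℂ) ≠ 0 :=
    norm_pos_iff.1 (one_pos.trans_le (S.one_le_norm_one_add x))
  exact Function.bijective_iff_has_inverse.2 ⟨S.formMul S.isPhiMultiplier_inv,
    key _ _ fun x => inv_mul_cancel₀ (h0 x), key _ _ fun x => mul_inv_cancel₀ (h0 x)⟩

/-- The operator that represents the form `Q + c` is invertible for a suitable `c`. -/
theorem bijective_coerciveOp (hd : 1 ≤ d) {γ₁ γ₂ : ℝ} (hγ : 0 < γ₁) (h : S.WeightBound γ₁ γ₂) :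
    Function.Bijective (S.coerciveOp (|γ₂| + 1)) := by
  set M := S.formMul S.isPhiMultiplier_one_add
  have hM := M.bijective_adjoint (bijective_formMul hd hγ h)
  -- Moving `M` across the inner product turns twisted coercivity of the form into plain coercivity
  -- of this composite.
  have hT : Function.Bijective (ContinuousLinearMap.adjoint M ∘L S.coerciveOp (|γ₂| + 1)) := by
    refine ContinuousLinearMap.bijective_of_coercive _ (lt_min one_half_pos hγ) fun x => ?_
    rw [ContinuousLinearMap.comp_apply, ContinuousLinearMap.adjoint_inner_right]
    exact coercive_formSpace hd hγ h x
  exact (Function.Bijective.of_comp_iff' hM _).1 hT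

/-! ### Elements of the completion as elements of the variational space -/

variable (S)

/-- The triple `(u, |V|^{1/2} u, (-i∇ + A) u)` for `u` in the variational space. -/
def graphV (u : S.variationalSpace) : S.GraphSpace :=
  WithLp.toLp 2 fun
    | none => (u : S.H)
    | some none => u.2.2.toLp _
    | some (some j) => S.magGradV u j

theorem graphV_none (u : S.variationalSpace) : S.graphV u none = (u : S.H) := rfl

theorem graphV_some_none (u : S.variationalSpace) :
    S.graphV u (some none) =ᵐ[volume.restrict S.Ω]
      fun x => ((Real.sqrt ‖S.V x‖ : ℝ) : ℂ) * (u : S.H) x :=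
  u.2.2.coeFn_toLp

theorem graphV_some_some (u : S.variationalSpace) (j : Fin d) :
    S.graphV u (some (some j)) = S.magGradV u j := rfl

/-- The form is represented by the operator in `L²(Ω)^{d+2}`. -/
theorem inner_graphV_formOp (c : ℝ) (u v : S.variationalSpace) :
    inner ℂ (S.graphV v) (S.formOp c (S.graphV u)) = S.Q u v + c * inner ℂ (v : S.H) (u : S.H) := by
  rw [inner_formOp, Q, graphV_none, graphV_none, IsBoundedMultiplier.inner_mulOp,
    PiLp.inner_apply (S.magGradV v)]
  have h : ∫ x in S.Ω, S.V x / ((‖S.V x‖ : ℝ) : ℂ) * S.graphV u (some none) x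
      * conj (S.graphV v (some none) x) = ∫ x in S.Ω, S.V x * (u : S.H) x * conj ((v : S.H) x) := by
    refine integral_congr_ae ?_
    filter_upwards [S.graphV_some_none u, S.graphV_some_none v] with x h1 h2
    rw [h1, h2, sign_V_mul]
  rw [h]
  simp only [graphV_some_some]
  ring

theorem isBoundedMultiplier_of_continuousOn {a : Space d → ℂ} (ha : ContinuousOn a S.Ω) {C : ℝ}
    (hC : ∀ x ∈ S.Ω, ‖a x‖ ≤ C) : S.IsBoundedMultiplier a :=
  ⟨ha.aestronglyMeasurable S.isOpen.measurableSet, C, hC⟩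

/-- Multiplication by `|V|^{1/2}` may be unbounded, so the relation `y₁ = |V|^{1/2} y₀` is divided
by `1 + |V|^{1/2}`. It then equates two bounded operators and defines a closed set, stable under
completion. -/
theorem isBoundedMultiplier_sqrt_div : S.IsBoundedMultiplier fun x =>
    (((Real.sqrt ‖S.V x‖ / (1 + Real.sqrt ‖S.V x‖) : ℝ)) : ℂ) := by
  refine S.isBoundedMultiplier_of_continuousOn (C := 1) ?_ fun x _ => ?_
  · refine Complex.continuous_ofReal.comp_continuousOn ?_
    have h : ContinuousOn (fun x => Real.sqrt ‖S.V x‖) S.Ω := S.continuousOn_V.norm.sqrt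
    exact h.div (continuousOn_const.add h) fun x _ => by positivity
  · rw [Complex.norm_real, Real.norm_of_nonneg (by positivity), div_le_one (by positivity)]
    linarith

theorem isBoundedMultiplier_one_div : S.IsBoundedMultiplier fun x =>
    (((1 / (1 + Real.sqrt ‖S.V x‖) : ℝ)) : ℂ) := by
  refine S.isBoundedMultiplier_of_continuousOn (C := 1) ?_ fun x _ => ?_
  · refine Complex.continuous_ofReal.comp_continuousOn ?_
    have h : ContinuousOn (fun x => Real.sqrt ‖S.V x‖) S.Ω := S.continuousOn_V.norm.sqrt
    exact continuousOn_const.div (continuousOn_const.add h) fun x _ => by positivity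
  · rw [Complex.norm_real, Real.norm_of_nonneg (by positivity), div_le_one (by positivity)]
    linarith [Real.sqrt_nonneg ‖S.V x‖]

variable {S}

/-- The weighted component of an element of the completion is `|V|^{1/2} u`. -/
theorem formSpace_weight {y : S.GraphSpace} (hy : y ∈ S.formSpace) :
    y (some none) =ᵐ[volume.restrict S.Ω]
      fun x => ((Real.sqrt ‖S.V x‖ : ℝ) : ℂ) * y none x := by
  have h : y ∈ {y : S.GraphSpace | S.isBoundedMultiplier_one_div.mulOp (y (some none))
      = S.isBoundedMultiplier_sqrt_div.mulOp (y none)} := by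
    refine closure_minimal ?_ (isClosed_eq (by fun_prop) (by fun_prop)) hy
    rintro _ ⟨f, rfl⟩
    refine Lp.ext ?_
    filter_upwards [S.isBoundedMultiplier_one_div.coeFn_mulOp (S.graphMap f (some none)),
      S.isBoundedMultiplier_sqrt_div.coeFn_mulOp (S.graphMap f none),
      coeFn_graphMap f (some none), coeFn_graphMap f none] with x h1 h2 h3 h4
    rw [h1, h2, h3, h4, component_none, component_some_none]
    push_cast
    ring
  rw [Set.mem_ofPred_eq] at h
  filter_upwards [S.isBoundedMultiplier_one_div.coeFn_mulOp (y (some none)),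
    S.isBoundedMultiplier_sqrt_div.coeFn_mulOp (y none)] with x h1 h2
  rw [h, h2] at h1
  have h3 : (1 + ((Real.sqrt ‖S.V x‖ : ℝ) : ℂ)) ≠ 0 := by
    have h4 : (1 + Real.sqrt ‖S.V x‖ : ℝ) ≠ 0 := by positivity
    exact_mod_cast h4
  push_cast at h1
  field_simp at h1
  exact h1.symm

/-- The projection of `L²(Ω)^{d+2}` forgetting the weighted component. -/
def gradProj (S : Potentials d) : S.GraphSpace →L[ℂ] WithLp 2 (S.H × S.HVec) :=
  ((WithLp.prodContinuousLinearEquiv 2 ℂ S.H S.HVec).symm :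
      S.H × S.HVec →L[ℂ] WithLp 2 (S.H × S.HVec)) ∘L
    (PiLp.proj 2 _ none).prod
      (((PiLp.continuousLinearEquiv 2 ℂ fun _ : Fin d => S.H).symm :
        (Fin d → S.H) →L[ℂ] S.HVec) ∘L
        ContinuousLinearMap.pi fun j => PiLp.proj 2 _ (some (some j)))

/-- The last components of an element of the completion form its magnetic gradient. -/
theorem isMagneticGradient_formSpace {y : S.GraphSpace} (hy : y ∈ S.formSpace) :
    S.IsMagneticGradient (y none) (WithLp.toLp 2 fun j => y (some (some j))) := by
  intro φ hφ j
  -- The distributional pairing is bilinear, so it becomes an inner product with the conjugate of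
  -- `φ`. In this form the defining identity is a closed condition, and on `C¹_0(Ω)` it is
  -- integration by parts.
  have e1 (u : S.H) : ∫ x in S.Ω, u x * φ x = inner ℂ (hφ.star_comp.memLp.toLp _ : S.H) u := by
    rw [inner_eq_integral]
    refine integral_congr_ae ?_
    filter_upwards [hφ.star_comp.memLp.coeFn_toLp] with x hx
    rw [hx, Complex.conj_conj]
  have hm := memLp_component hφ.star_comp.mem_compactC1 (some (some j))
  have hψ : ∀ x, conj (S.component (fun x => conj (φ x)) (some (some j)) x)
      = Complex.I * fderiv ℝ φ x (basisVec j) + (S.A x j : ℂ) * φ x := by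
    intro x
    have h1 : HasFDerivAt (fun x => conj (φ x))
        ((Complex.conjCLE : ℂ →L[ℝ] ℂ).comp (fderiv ℝ φ x)) x :=
      (Complex.conjCLE : ℂ →L[ℝ] ℂ).hasFDerivAt.comp x
        (hφ.smooth.differentiable (by simp) x).hasFDerivAt
    rw [component_some_some, h1.fderiv]
    simp
  have e2 (u : S.H) : ∫ x in S.Ω, u x *
      (Complex.I * fderiv ℝ φ x (basisVec j) + (S.A x j : ℂ) * φ x)
      = inner ℂ (hm.toLp _ : S.H) u := by
    rw [inner_eq_integral]
    refine integral_congr_ae ?_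
    filter_upwards [hm.coeFn_toLp] with x hx
    rw [hx, hψ]
  change ∫ x in S.Ω, y (some (some j)) x * φ x = _
  rw [e1, e2]
  have h : y ∈ {y : S.GraphSpace | inner ℂ (hφ.star_comp.memLp.toLp _ : S.H) (y (some (some j)))
      = inner ℂ (hm.toLp _ : S.H) (y none)} := by
    refine closure_minimal ?_ (isClosed_eq (by fun_prop) (by fun_prop)) hy
    rintro _ ⟨f, rfl⟩
    change inner ℂ (hφ.star_comp.memLp.toLp _ : S.H) (S.graphMap f (some (some j)))
      = inner ℂ (hm.toLp _ : S.H) (S.graphMap f none)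
    rw [graphMap_apply, graphMap_apply, inner_toLp, inner_toLp]
    exact integral_component_mul_conj f.2 hφ.star_comp.mem_compactC1 j
  exact h

theorem graphMap_mem_formSpace (f : S.compactC1) : S.graphMap f ∈ S.formSpace :=
  Submodule.le_topologicalClosure _ (LinearMap.mem_range_self _ f)

theorem mem_H1A_of_formSpace {y : S.GraphSpace} (hy : y ∈ S.formSpace) : y none ∈ S.H1A :=
  ⟨_, isMagneticGradient_formSpace hy⟩

theorem h1Embedding_of_formSpace {y : S.GraphSpace} (hy : y ∈ S.formSpace) :
    S.h1Embedding ⟨y none, mem_H1A_of_formSpace hy⟩ = S.gradProj y := by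
  have h := (S.isMagneticGradient_magGrad ⟨y none, mem_H1A_of_formSpace hy⟩).unique
    (isMagneticGradient_formSpace hy)
  change WithLp.toLp 2 (y none, S.magGrad ⟨y none, mem_H1A_of_formSpace hy⟩) = _
  rw [h]
  rfl

theorem gradProj_mem_of_isTestFunction {f : S.compactC1} (hf : S.IsTestFunction f) :
    S.gradProj (S.graphMap f) ∈ S.testSpace.map S.h1Embedding := by
  rw [← h1Embedding_of_formSpace (graphMap_mem_formSpace f)]
  exact Submodule.mem_map_of_mem ⟨f, hf, coeFn_graphMap f none⟩

/-- The first component of an element of the completion lies in the variational space. -/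
theorem mem_variationalSpace_of_formSpace {y : S.GraphSpace} (hy : y ∈ S.formSpace) :
    y none ∈ S.variationalSpace := by
  refine ⟨⟨⟨y none, mem_H1A_of_formSpace hy⟩, ?_, rfl⟩,
    (memLp_congr_ae (formSpace_weight hy)).1 (Lp.memLp (y (some none)))⟩
  change S.h1Embedding _ ∈ (S.testSpace.map S.h1Embedding).topologicalClosure
  rw [h1Embedding_of_formSpace hy]
  refine map_mem_closure S.gradProj.continuous (S.formSpace_subset_closure hy) ?_
  rintro _ ⟨f, hf, rfl⟩
  exact gradProj_mem_of_isTestFunction hf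

/-- No information is lost in passing to the first component: the weight relation and the uniqueness
of the distributional gradient recover the others. This makes the form closable, in the sense that
the completion embeds in `L²(Ω)`. -/
theorem graphV_of_formSpace {y : S.GraphSpace} (hy : y ∈ S.formSpace) :
    S.graphV ⟨y none, mem_variationalSpace_of_formSpace hy⟩ = y := by
  set u : S.variationalSpace := ⟨y none, mem_variationalSpace_of_formSpace hy⟩
  ext1 i
  match i with
  | none => rfl
  | some none =>
    exact Lp.ext ((S.graphV_some_none u).trans (formSpace_weight hy).symm)
  | some (some j) =>
    have h := (S.isMagneticGradient_magGrad ⟨y none, mem_H1A_of_formSpace hy⟩).unique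
      (isMagneticGradient_formSpace hy)
    exact congrArg (fun w : S.HVec => w j) h

/-! ### The variational space inside the completion, by cutoffs -/

/-- Smooth cutoff functions that exhaust the space. -/
def cutoff (n : ℕ) (x : Space d) : ℂ :=
  (((⟨1, 2, one_pos, one_lt_two⟩ : ContDiffBump (0 : Space d)) ((n + 1 : ℝ)⁻¹ • x) : ℝ) : ℂ)

theorem contDiff_cutoff (n : ℕ) : ContDiff ℝ ∞ (cutoff (d := d) n) :=
  Complex.ofRealCLM.contDiff.comp ((ContDiffBump.contDiff _).comp (contDiff_const_smul _))

theorem norm_cutoff_le (n : ℕ) (x : Space d) : ‖cutoff n x‖ ≤ 1 := by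
  rw [cutoff, Complex.norm_real, Real.norm_of_nonneg (ContDiffBump.nonneg _)]
  exact ContDiffBump.le_one _

theorem cutoff_eq_one {n : ℕ} {x : Space d} (hx : ‖x‖ ≤ n + 1) : cutoff n x = 1 := by
  rw [cutoff, ContDiffBump.one_of_mem_closedBall, Complex.ofReal_one]
  rw [mem_closedBall_zero_iff, norm_smul, Real.norm_of_nonneg (by positivity)]
  rwa [inv_mul_eq_div, div_le_one (by positivity)]

theorem cutoff_eq_zero {n : ℕ} {x : Space d} (hx : 2 * (n + 1) ≤ ‖x‖) : cutoff n x = 0 := by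
  rw [cutoff, ContDiffBump.zero_of_le_dist, Complex.ofReal_zero]
  rw [dist_zero_right, norm_smul, Real.norm_of_nonneg (by positivity)]
  rwa [inv_mul_eq_div, le_div_iff₀ (by positivity)]

theorem fderiv_cutoff_eq_zero {n : ℕ} {x : Space d} (hx : ‖x‖ < n + 1) :
    fderiv ℝ (cutoff n) x = 0 := by
  have h : cutoff n =ᶠ[nhds x] fun _ => 1 := by
    filter_upwards [(isOpen_lt continuous_norm continuous_const).mem_nhds hx] with y hy
    exact cutoff_eq_one hy.le
  rw [h.fderiv_eq]
  simp

/-- All cutoffs are dilations of the one with index `0`, and the chain rule contributes the factor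
`(n + 1)⁻¹ ≤ 1`. -/
theorem exists_norm_fderiv_cutoff_le (j : Fin d) :
    ∃ C : ℝ, ∀ n x, ‖fderiv ℝ (cutoff n) x (basisVec j)‖ ≤ C := by
  set b : Space d → ℂ := cutoff 0
  have hb : ContDiff ℝ ∞ b := contDiff_cutoff 0
  have hs : HasCompactSupport b := by
    refine HasCompactSupport.intro (isCompact_closedBall (0 : Space d) 2) fun x hx => ?_
    rw [mem_closedBall_zero_iff, not_le] at hx
    exact cutoff_eq_zero (by simpa using hx.le)
  obtain ⟨C, hC⟩ := (hb.continuous_fderiv (by simp)).bounded_above_of_compact_support (hs.fderiv ℝ)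
  refine ⟨C, fun n x => ?_⟩
  have h1 : cutoff n = fun x : Space d => b ((n + 1 : ℝ)⁻¹ • x) := by
    funext x
    simp [b, cutoff]
  have h2 : (n + 1 : ℝ)⁻¹ ≤ 1 := inv_le_one_of_one_le₀ (by linarith [n.cast_nonneg (α := ℝ)])
  have h3 := (fderiv ℝ b ((n + 1 : ℝ)⁻¹ • x)).le_opNorm (basisVec j)
  have h4 : ‖(basisVec j : Space d)‖ = 1 := by simp [basisVec]
  rw [h4, mul_one] at h3
  rw [h1, fderiv_comp_smul, smul_apply, norm_smul, Real.norm_of_nonneg (by positivity)]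
  exact (mul_le_of_le_one_left (norm_nonneg _) h2).trans (h3.trans (hC _))

variable (S)

theorem isBoundedMultiplier_cutoff (n : ℕ) : S.IsBoundedMultiplier (cutoff n) :=
  S.isBoundedMultiplier_of_continuousOn (contDiff_cutoff n).continuous.continuousOn
    fun x _ => norm_cutoff_le n x

theorem isBoundedMultiplier_fderiv_cutoff (n : ℕ) (j : Fin d) :
    S.IsBoundedMultiplier fun x => fderiv ℝ (cutoff n) x (basisVec j) :=
  S.isBoundedMultiplier_of_continuousOn
    (((contDiff_cutoff n).continuous_fderiv (by simp)).clm_apply continuous_const).continuousOn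
    fun x _ => (exists_norm_fderiv_cutoff_le j).choose_spec n x

/-- `V` is bounded in the bounded subsets of `Ω`, since it extends continuously to the closure. -/
theorem exists_norm_V_le (R : ℝ) : ∃ C : ℝ, ∀ x ∈ S.Ω, ‖x‖ ≤ R → ‖S.V x‖ ≤ C := by
  obtain ⟨g, hg, hgV⟩ := S.V_reg.2 0 (Nat.zero_le _)
  have hK : IsCompact (closure S.Ω ∩ Metric.closedBall 0 R) :=
    (isCompact_closedBall _ _).inter_left isClosed_closure
  obtain ⟨C, hC⟩ := hK.exists_bound_of_continuousOn (hg.mono Set.inter_subset_left)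
  refine ⟨C, fun x hx hR => ?_⟩
  rw [← norm_iteratedFDeriv_zero (𝕜 := ℝ), ← hgV x hx]
  exact hC x ⟨subset_closure hx, mem_closedBall_zero_iff.2 hR⟩

/-- This is where continuity of `V` up to the boundary matters: on the support of the cutoff, even
near `∂Ω`, `|V|` is bounded. -/
theorem isBoundedMultiplier_sqrt_V_cutoff (n : ℕ) :
    S.IsBoundedMultiplier fun x => ((Real.sqrt ‖S.V x‖ : ℝ) : ℂ) * cutoff n x := by
  obtain ⟨C, hC⟩ := S.exists_norm_V_le (2 * (n + 1))
  refine S.isBoundedMultiplier_of_continuousOn (C := Real.sqrt C)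
    (S.continuousOn_sqrt_V.mul (contDiff_cutoff n).continuous.continuousOn) fun x hx => ?_
  rcases le_total ‖x‖ (2 * (n + 1)) with h | h
  · rw [norm_mul, Complex.norm_real, Real.norm_of_nonneg (Real.sqrt_nonneg _)]
    exact (mul_le_of_le_one_right (Real.sqrt_nonneg _) (norm_cutoff_le n x)).trans
      (Real.sqrt_le_sqrt (hC x hx h))
  · rw [cutoff_eq_zero h, mul_zero, norm_zero]
    exact Real.sqrt_nonneg _

variable {S}

/-- Uniformly bounded multipliers that converge pointwise converge strongly. -/
theorem tendsto_mulOp {a : ℕ → Space d → ℂ} (ha : ∀ n, S.IsBoundedMultiplier (a n)) {C : ℝ}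
    (hC : ∀ n x, ‖a n x‖ ≤ C) {l : ℂ}
    (hl : ∀ x, Filter.Tendsto (fun n => a n x) Filter.atTop (nhds l)) (u : S.H) :
    Filter.Tendsto (fun n => (ha n).mulOp u) Filter.atTop (nhds (l • u)) := by
  rw [tendsto_iff_norm_sub_tendsto_zero]
  have h1 (n : ℕ) : ‖(ha n).mulOp u - l • u‖ ^ 2 = ∫ x in S.Ω, ‖(a n x - l) * u x‖ ^ 2 := by
    rw [norm_sq_eq_integral]
    refine integral_congr_ae ?_
    filter_upwards [Lp.coeFn_sub ((ha n).mulOp u) (l • u), (ha n).coeFn_mulOp u,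
      Lp.coeFn_smul l u] with x e1 e2 e3
    rw [e1, Pi.sub_apply, e2, e3, Pi.smul_apply, smul_eq_mul, sub_mul]
  have hint : Integrable (fun x => ‖u x‖ ^ 2) (volume.restrict S.Ω) :=
    (Lp.memLp u).integrable_norm_pow two_ne_zero
  have h2 : Filter.Tendsto (fun n => ∫ x in S.Ω, ‖(a n x - l) * u x‖ ^ 2) Filter.atTop
      (nhds (∫ x in S.Ω, (0 : ℝ))) := by
    -- The uniform bound on the multipliers gives an integrable majorant of the squared error.
    refine tendsto_integral_of_dominated_convergence (fun x => (C + ‖l‖) ^ 2 * ‖u x‖ ^ 2)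
      (fun n => ?_) (hint.const_mul _) (fun n => ?_) ?_
    · exact ((((ha n).aestronglyMeasurable.sub aestronglyMeasurable_const).mul
        (Lp.aestronglyMeasurable u)).norm.pow 2)
    · refine Filter.Eventually.of_forall fun x => ?_
      rw [Real.norm_of_nonneg (sq_nonneg _), norm_mul, mul_pow]
      refine mul_le_mul_of_nonneg_right (pow_le_pow_left₀ (norm_nonneg _) ?_ 2) (sq_nonneg _)
      exact (norm_sub_le _ _).trans (add_le_add (hC n x) le_rfl)
    · refine Filter.Eventually.of_forall fun x => ?_
      have h3 := ((((hl x).sub_const l).mul_const (u x)).norm.pow 2)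
      simpa using h3
  rw [integral_zero] at h2
  have h3 := h2.sqrt
  rw [Real.sqrt_zero] at h3
  refine h3.congr fun n => ?_
  rw [← h1, Real.sqrt_sq (norm_nonneg _)]

theorem tendsto_mulOp_cutoff (u : S.H) : Filter.Tendsto
    (fun n => (S.isBoundedMultiplier_cutoff n).mulOp u) Filter.atTop (nhds u) := by
  have h := tendsto_mulOp (l := 1) S.isBoundedMultiplier_cutoff norm_cutoff_le (fun x => ?_) u
  · rwa [one_smul] at h
  · refine tendsto_const_nhds.congr' ?_
    filter_upwards [Filter.eventually_ge_atTop ⌈‖x‖⌉₊] with n hn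
    have := (Nat.ceil_le.1 hn)
    exact (cutoff_eq_one (by linarith)).symm

theorem tendsto_mulOp_fderiv_cutoff (j : Fin d) (u : S.H) : Filter.Tendsto
    (fun n => (S.isBoundedMultiplier_fderiv_cutoff n j).mulOp u) Filter.atTop (nhds 0) := by
  obtain ⟨C, hC⟩ := exists_norm_fderiv_cutoff_le j
  have h := tendsto_mulOp (l := 0) (fun n => S.isBoundedMultiplier_fderiv_cutoff n j) hC
    (fun x => ?_) u
  · rwa [zero_smul] at h
  · refine tendsto_const_nhds.congr' ?_
    filter_upwards [Filter.eventually_ge_atTop ⌈‖x‖⌉₊] with n hn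
    have := (Nat.ceil_le.1 hn)
    rw [fderiv_cutoff_eq_zero (by linarith), zero_apply]

variable (S)

/-- The components of `cutoffOp`. -/
def cutoffComponent (n : ℕ) :
    Option (Option (Fin d)) → WithLp 2 (S.H × S.HVec) →L[ℂ] S.H
  | none => (S.isBoundedMultiplier_cutoff n).mulOp ∘L WithLp.fstL 2 ℂ S.H S.HVec
  | some none => (S.isBoundedMultiplier_sqrt_V_cutoff n).mulOp ∘L WithLp.fstL 2 ℂ S.H S.HVec
  | some (some j) => (S.isBoundedMultiplier_cutoff n).mulOp ∘L PiLp.proj 2 _ j ∘L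
      WithLp.sndL 2 ℂ S.H S.HVec
      - Complex.I • ((S.isBoundedMultiplier_fderiv_cutoff n j).mulOp ∘L
        WithLp.fstL 2 ℂ S.H S.HVec)

/-- The operator that maps `(u, (-i∇ + A) u)` to the triple of `χ u`, for a cutoff `χ`. -/
def cutoffOp (n : ℕ) : WithLp 2 (S.H × S.HVec) →L[ℂ] S.GraphSpace :=
  ((PiLp.continuousLinearEquiv 2 ℂ fun _ : Option (Option (Fin d)) => S.H).symm :
      (Option (Option (Fin d)) → S.H) →L[ℂ] S.GraphSpace) ∘L
    ContinuousLinearMap.pi (S.cutoffComponent n)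

variable {S}

/-- By the product rule `P(χf) = χPf - i(∇χ)f`. After the cutoff, the weighted component too depends
continuously on `f` in `L²(Ω)`, so the `H¹_A` data alone determine the whole triple. -/
theorem cutoffOp_gradProj_graphMap (n : ℕ) (f : S.compactC1) :
    S.cutoffOp n (S.gradProj (S.graphMap f))
      = S.graphMap (mulC1 ((contDiff_cutoff n).of_le (by exact_mod_cast le_top)).contDiffOn f) := by
  have hg : ContDiffOn ℝ 1 (cutoff n) S.Ω :=
    ((contDiff_cutoff n).of_le (by exact_mod_cast le_top)).contDiffOn
  ext1 i
  match i with
  | none =>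
    change (S.isBoundedMultiplier_cutoff n).mulOp (S.graphMap f none) = _
    refine Lp.ext ?_
    filter_upwards [(S.isBoundedMultiplier_cutoff n).coeFn_mulOp (S.graphMap f none),
      coeFn_graphMap f none, coeFn_graphMap (mulC1 hg f) none] with x h1 h2 h3
    rw [h1, h2, h3]
    rfl
  | some none =>
    change (S.isBoundedMultiplier_sqrt_V_cutoff n).mulOp (S.graphMap f none) = _
    refine Lp.ext ?_
    filter_upwards [(S.isBoundedMultiplier_sqrt_V_cutoff n).coeFn_mulOp (S.graphMap f none),
      coeFn_graphMap f none, coeFn_graphMap (mulC1 hg f) (some none)] with x h1 h2 h3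
    rw [h1, h2, h3, component_none, component_some_none, mulC1_apply, mul_assoc]
  | some (some j) =>
    change (S.isBoundedMultiplier_cutoff n).mulOp (S.graphMap f (some (some j)))
      - Complex.I • (S.isBoundedMultiplier_fderiv_cutoff n j).mulOp (S.graphMap f none) = _
    refine Lp.ext ?_
    filter_upwards [Lp.coeFn_sub ((S.isBoundedMultiplier_cutoff n).mulOp
        (S.graphMap f (some (some j)))) (Complex.I •
        (S.isBoundedMultiplier_fderiv_cutoff n j).mulOp (S.graphMap f none)),
      Lp.coeFn_smul Complex.I ((S.isBoundedMultiplier_fderiv_cutoff n j).mulOp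
        (S.graphMap f none)),
      (S.isBoundedMultiplier_cutoff n).coeFn_mulOp (S.graphMap f (some (some j))),
      (S.isBoundedMultiplier_fderiv_cutoff n j).coeFn_mulOp (S.graphMap f none),
      coeFn_graphMap f none, coeFn_graphMap f (some (some j)),
      coeFn_graphMap (mulC1 hg f) (some (some j)),
      ae_restrict_mem S.isOpen.measurableSet] with x h1 h2 h3 h4 h5 h6 h7 hx
    have h8 : S.component (mulC1 hg f) (some (some j)) x = _ := component_mul hg f.2 j hx
    rw [h1, Pi.sub_apply, h2, Pi.smul_apply, h3, h4, h5, h6, h7, h8, component_none, smul_eq_mul,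
      mul_assoc]

theorem exists_graphMap_of_mem_testSpace {t : S.H1A} (ht : t ∈ S.testSpace) :
    ∃ f : S.compactC1, S.h1Embedding t = S.gradProj (S.graphMap f) := by
  obtain ⟨φ, hφ, h⟩ := ht
  refine ⟨⟨φ, hφ.mem_compactC1⟩, ?_⟩
  rw [← h1Embedding_of_formSpace (graphMap_mem_formSpace ⟨φ, hφ.mem_compactC1⟩)]
  congr 1
  exact Subtype.ext (Lp.ext (h.trans (coeFn_graphMap ⟨φ, hφ.mem_compactC1⟩ none).symm))

/-- Approximation of `u` in `H¹_A` says nothing about `|V|^{1/2}u`, but `cutoffOp` is continuous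
from the `H¹_A` norm to the variational norm, so the approximants multiplied by the cutoff converge
in the latter. -/
theorem cutoffOp_mem_formSpace (n : ℕ) {u : S.H1A} (hu : u ∈ S.H1A0) :
    S.cutoffOp n (S.h1Embedding u) ∈ S.formSpace := by
  have hcl : closure (S.formSpace : Set S.GraphSpace) = S.formSpace :=
    (Submodule.isClosed_topologicalClosure _).closure_eq
  change _ ∈ (S.formSpace : Set S.GraphSpace)
  rw [← hcl]
  refine map_mem_closure (S.cutoffOp n).continuous hu ?_
  rintro _ ⟨t, ht, rfl⟩
  obtain ⟨f, hf⟩ := exists_graphMap_of_mem_testSpace ht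
  rw [hf, cutoffOp_gradProj_graphMap]
  exact graphMap_mem_formSpace _

/-- Removing the cutoff is dominated convergence in each component. In the weighted one the cutoff
acts on `|V|^{1/2}u`, which is in `L²(Ω)` by the definition of `𝒱`; in the gradient, the commutator
with the cutoff tends to zero. -/
theorem tendsto_cutoffOp (u : S.variationalSpace) : Filter.Tendsto
    (fun n => S.cutoffOp n (S.h1Embedding (Submodule.inclusion S.variationalSpace_le u)))
    Filter.atTop (nhds (S.graphV u)) := by
  have h : Filter.Tendsto (fun n i => S.cutoffOp n (S.h1Embedding
      (Submodule.inclusion S.variationalSpace_le u)) i) Filter.atTop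
      (nhds (fun i => S.graphV u i)) := by
    rw [tendsto_pi_nhds]
    intro i
    match i with
    | none => exact tendsto_mulOp_cutoff (u : S.H)
    | some none =>
      refine (tendsto_mulOp_cutoff (S.graphV u (some none))).congr fun n => ?_
      change _ = (S.isBoundedMultiplier_sqrt_V_cutoff n).mulOp (u : S.H)
      refine Lp.ext ?_
      filter_upwards [(S.isBoundedMultiplier_cutoff n).coeFn_mulOp (S.graphV u (some none)),
        (S.isBoundedMultiplier_sqrt_V_cutoff n).coeFn_mulOp (u : S.H),
        S.graphV_some_none u] with x h1 h2 h3
      rw [h1, h2, h3]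
      ring
    | some (some j) =>
      have h1 := (tendsto_mulOp_cutoff (S.graphV u (some (some j)))).sub
        ((tendsto_mulOp_fderiv_cutoff j (u : S.H)).const_smul Complex.I)
      rw [smul_zero, sub_zero] at h1
      exact h1
  exact ((PiLp.continuousLinearEquiv 2 ℂ fun _ : Option (Option (Fin d)) => S.H).symm
    |>.continuous.tendsto _).comp h

/-- The variational space is contained in the completion of `C¹_0(Ω)`. -/
theorem graphV_mem_formSpace (u : S.variationalSpace) : S.graphV u ∈ S.formSpace := by
  refine (Submodule.isClosed_topologicalClosure _).mem_of_tendsto (tendsto_cutoffOp u)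
    (Filter.Eventually.of_forall fun n => cutoffOp_mem_formSpace n ?_)
  obtain ⟨⟨v, hv, hvu⟩, _⟩ := u.2
  have h : v = Submodule.inclusion S.variationalSpace_le u := Subtype.ext hvu
  rwa [← h]

/-! ### The operator, its resolvent and the three conclusions -/

theorem mem_domain_of_forall {u : S.H} (hu : u ∈ S.variationalSpace) {f : S.H}
    (h : ∀ v : S.variationalSpace, S.Q ⟨u, hu⟩ v = inner ℂ (v : S.H) f) :
    ∃ hd : u ∈ S.operator.domain, S.operator ⟨u, hd⟩ = f := by
  have hd : u ∈ S.operator.domain := by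
    refine ⟨hu, ?_⟩
    simp only [h]
    exact continuous_subtype_val.inner continuous_const
  refine ⟨hd, S.eq_of_forall_inner fun v => ?_⟩
  rw [← S.Q_eq_inner_operator ⟨u, hd⟩ v, ← h v]
  rfl

variable (S)

/-- The embedding of the completion of `C¹_0(Ω)` into `L²(Ω)`. -/
def formEmbedding : S.formSpace →L[ℂ] S.H :=
  (PiLp.proj 2 (fun _ : Option (Option (Fin d)) => S.H) none) ∘L S.formSpace.subtypeL

variable {S}

theorem formEmbedding_mem (y : S.formSpace) : S.formEmbedding y ∈ S.variationalSpace :=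
  mem_variationalSpace_of_formSpace y.2

theorem formEmbedding_injective : Function.Injective S.formEmbedding := by
  intro y z h
  have hyz : (⟨_, formEmbedding_mem y⟩ : S.variationalSpace) = ⟨_, formEmbedding_mem z⟩ :=
    Subtype.ext h
  refine Subtype.ext ?_
  rw [← graphV_of_formSpace y.2, ← graphV_of_formSpace z.2]
  exact congrArg S.graphV hyz

/-- A vector killed by the adjoint is orthogonal to the range of the embedding, which contains `𝒱`
and hence all test functions. -/
theorem formEmbedding_adjoint_injective {f : S.H}
    (h : ContinuousLinearMap.adjoint S.formEmbedding f = 0) : f = 0 := by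
  refine S.eq_of_forall_inner fun v => ?_
  have h1 : inner ℂ (S.formEmbedding ⟨S.graphV v, graphV_mem_formSpace v⟩) f = 0 := by
    rw [← ContinuousLinearMap.adjoint_inner_right, h, inner_zero_right]
  rw [inner_zero_right]
  exact h1

theorem inner_graphV_coerciveOp (c : ℝ) (y : S.formSpace) (v : S.variationalSpace) :
    inner ℂ (⟨S.graphV v, graphV_mem_formSpace v⟩ : S.formSpace) (S.coerciveOp c y)
      = S.Q ⟨_, formEmbedding_mem y⟩ v + c * inner ℂ (v : S.H) (S.formEmbedding y) := by
  rw [inner_coerciveOp, ← inner_graphV_formOp]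
  change inner ℂ (S.graphV v) _ = _
  rw [show S.graphV ⟨_, formEmbedding_mem y⟩ = y from graphV_of_formSpace y.2]

/-- The solutions of the variational problem solve `(ℒ + c) u = f`. -/
theorem formEmbedding_mem_domain {c : ℝ} {y : S.formSpace} {f : S.H}
    (h : S.coerciveOp c y = ContinuousLinearMap.adjoint S.formEmbedding f) :
    ∃ hd : S.formEmbedding y ∈ S.operator.domain,
      S.operator ⟨_, hd⟩ = f - (c : ℂ) • S.formEmbedding y := by
  refine mem_domain_of_forall (formEmbedding_mem y) fun v => ?_
  have h1 := inner_graphV_coerciveOp c y v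
  rw [h, ContinuousLinearMap.adjoint_inner_right] at h1
  rw [inner_sub_right, inner_smul_right]
  exact (sub_eq_of_eq_add h1).symm

/-- Converse of `formEmbedding_mem_domain`; together they make `(ℒ + c)u = f` equivalent to an
equation for a bounded operator in the completion. -/
theorem coerciveOp_of_mem_domain (c : ℝ) (u : S.operator.domain) :
    ∃ y : S.formSpace, S.formEmbedding y = u ∧ S.coerciveOp c y
      = ContinuousLinearMap.adjoint S.formEmbedding (S.operator u + (c : ℂ) • (u : S.H)) := by
  set u' : S.variationalSpace := Submodule.inclusion S.operatorDomain_le u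
  refine ⟨⟨S.graphV u', graphV_mem_formSpace u'⟩, rfl, ext_inner_left ℂ fun k => ?_⟩
  -- Every vector of the completion comes from `𝒱`, so the defining identity of `ℒ` tests against
  -- all of them.
  have hk : k = ⟨S.graphV ⟨_, formEmbedding_mem k⟩, graphV_mem_formSpace _⟩ :=
    Subtype.ext (graphV_of_formSpace k.2).symm
  rw [ContinuousLinearMap.adjoint_inner_right, inner_add_right, inner_smul_right]
  have h1 := S.Q_eq_inner_operator u ⟨_, formEmbedding_mem k⟩
  have h2 := inner_graphV_coerciveOp c ⟨S.graphV u', graphV_mem_formSpace u'⟩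
    ⟨_, formEmbedding_mem k⟩
  rw [← hk] at h2
  rw [h2]
  exact congrArg (· + _) h1

variable {c : ℝ}

/-- The operator that represents the form `Q + c`, as an equivalence when it is bijective. -/
def coerciveEquiv (hA : Function.Bijective (S.coerciveOp c)) : S.formSpace ≃L[ℂ] S.formSpace :=
  ContinuousLinearEquiv.ofBijective (S.coerciveOp c) (LinearMap.ker_eq_bot.2 hA.1)
    (LinearMap.range_eq_top.2 hA.2)

/-- The inverse of `ℒ + c`. -/
def resolventOp (hA : Function.Bijective (S.coerciveOp c)) : S.H →L[ℂ] S.H :=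
  S.formEmbedding ∘L ((coerciveEquiv hA).symm : S.formSpace →L[ℂ] S.formSpace) ∘L
    ContinuousLinearMap.adjoint S.formEmbedding

theorem resolventOp_apply (hA : Function.Bijective (S.coerciveOp c)) {y : S.formSpace} {f : S.H}
    (h : S.coerciveOp c y = ContinuousLinearMap.adjoint S.formEmbedding f) :
    resolventOp hA f = S.formEmbedding y := by
  refine congrArg S.formEmbedding ?_
  exact (congrArg (coerciveEquiv hA).symm h.symm).trans ((coerciveEquiv hA).symm_apply_apply y)

theorem resolventOp_operator (hA : Function.Bijective (S.coerciveOp c)) (u : S.operator.domain) :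
    resolventOp hA (S.operator u + (c : ℂ) • (u : S.H)) = u := by
  obtain ⟨y, hy, h⟩ := coerciveOp_of_mem_domain c u
  rw [resolventOp_apply hA h, hy]

theorem operator_resolventOp (hA : Function.Bijective (S.coerciveOp c)) (f : S.H) :
    ∃ hd : resolventOp hA f ∈ S.operator.domain,
      S.operator ⟨_, hd⟩ = f - (c : ℂ) • resolventOp hA f := by
  obtain ⟨y, hy⟩ := hA.2 (ContinuousLinearMap.adjoint S.formEmbedding f)
  rw [resolventOp_apply hA hy]
  exact formEmbedding_mem_domain hy

/-- Let `f` be orthogonal to the range of `ι𝒜⁻¹ι*`, and solve `𝒜*k = ι*f`. Then `⟨h, ιk⟩ = 0` for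
every `h`, so `k = 0` because `ι` is injective, and `f = 0` because `ι*` is injective. -/
theorem dense_domain_of_bijective (hA : Function.Bijective (S.coerciveOp c)) :
    Dense (S.operator.domain : Set S.H) := by
  rw [Submodule.dense_iff_topologicalClosure_eq_top, Submodule.topologicalClosure_eq_top_iff,
    Submodule.eq_bot_iff]
  intro f hf
  obtain ⟨k, hk⟩ := ((S.coerciveOp c).bijective_adjoint hA).2
    (ContinuousLinearMap.adjoint S.formEmbedding f)
  have h1 (h : S.H) : inner ℂ h (S.formEmbedding k) = 0 := by
    obtain ⟨y, hy⟩ := hA.2 (ContinuousLinearMap.adjoint S.formEmbedding h)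
    have h2 := (Submodule.mem_orthogonal _ f).1 hf _ (formEmbedding_mem_domain hy).choose
    rw [← ContinuousLinearMap.adjoint_inner_right, ← hk, ContinuousLinearMap.adjoint_inner_right,
      hy, ContinuousLinearMap.adjoint_inner_left] at h2
    exact h2
  have h3 : S.formEmbedding k = 0 := inner_self_eq_zero.1 (h1 _)
  have h4 : k = 0 := formEmbedding_injective (h3.trans (map_zero _).symm)
  rw [h4, map_zero] at hk
  exact formEmbedding_adjoint_injective hk.symm

/-- With `R` the bounded inverse of `ℒ + c`, the graph is the set of pairs `(u, f)` with `R(f + cu)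
= u`, a closed condition. -/
theorem isClosed_of_bijective (hA : Function.Bijective (S.coerciveOp c)) :
    S.operator.IsClosed := by
  have h : (S.operator.graph : Set (S.H × S.H))
      = {p | resolventOp hA (p.2 + (c : ℂ) • p.1) = p.1} := by
    ext ⟨u, f⟩
    rw [SetLike.mem_coe, LinearPMap.mem_graph_iff, Set.mem_ofPred_eq]
    constructor
    · rintro ⟨v, hv, hf⟩
      simp only at hv hf ⊢
      rw [← hv, ← hf]
      exact resolventOp_operator hA v
    · intro hu
      obtain ⟨hd, hf⟩ := operator_resolventOp hA (f + (c : ℂ) • u)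
      refine ⟨⟨_, hd⟩, hu, ?_⟩
      rw [hf]
      simp only at hu ⊢
      rw [hu, add_sub_cancel_right]
  rw [LinearPMap.IsClosed, h]
  exact isClosed_eq (by fun_prop) (by fun_prop)

theorem mem_resolventSet_of_bijective (hA : Function.Bijective (S.coerciveOp c)) :
    -(c : ℂ) ∈ resolventSet S.operator := by
  constructor
  · intro u v huv
    simp only [neg_smul, sub_neg_eq_add] at huv
    refine Subtype.ext ?_
    rw [← resolventOp_operator hA u, huv, resolventOp_operator hA v]
  · intro f
    obtain ⟨hd, hf⟩ := operator_resolventOp hA f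
    refine ⟨⟨_, hd⟩, ?_⟩
    simp only [neg_smul, sub_neg_eq_add]
    rw [hf, sub_add_cancel]

end Potentials
end Electromagnetic
end

theorem mainTheorem2 {d : ℕ} (hd : 1 ≤ d) (S : Electromagnetic.Potentials d)
    (hS : S.WeightedCondition) :
    Dense (S.operator.domain : Set S.H) ∧
      S.operator.IsClosed ∧
      (Electromagnetic.resolventSet S.operator).Nonempty := by
  obtain ⟨γ₁, γ₂, hγ, h⟩ := hS.exists_weightBound
  have hA := Electromagnetic.Potentials.bijective_coerciveOp hd hγ h
  exact ⟨Electromagnetic.Potentials.dense_domain_of_bijective hA,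
    Electromagnetic.Potentials.isClosed_of_bijective hA,
    _, Electromagnetic.Potentials.mem_resolventSet_of_bijective hA⟩
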